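/- Let $S^\bullet=\mathbb Z[1/4][a,b,\Delta^{-1}]$ with $\Delta=a^2b^4(a^2-16b)$, and let $S^\bullet_3=S^\bullet[\kappa]/(W(\kappa))$ with $$W(\kappa)=\kappa^4-\frac{6}{b^2}\kappa^2+\frac{a^2-8b}{b^4}\kappa-\frac{3}{b^4}.$$ For $\alpha,\beta\in S^\bullet_3$ let $C_{\alpha,\beta}$ be the projective plane cubic over $\operatorname{Spec}S^\bullet_3$ with equation $y^2+\alpha xy+\alpha\beta y=x^3+\beta x^2$; in the coordinates $u=x/y$, $v=1/y$ it reads $v+\alpha uv+\alpha\beta v^2=u^3+\beta u^2v$, with identity $(u,v)=(0,0)$. Put $C=C_{a,b}$ and $C'=C_{a',b'}$, where $(a',b')=T(a,b,\kappa)$ and $$T(a,b,\kappa)=\Bigl(\tfrac1a\bigl((a^2b^4-4b^5)\kappa^3+4b^4\kappa^2+(-6a^2b^2+20b^3)\kappa+a^4-12a^2b+12b^2\bigr),\; b^3\Bigr).$$ A subgroup of order $3$ of $C_{\alpha,\beta}$ with parameter $k\in S^\bullet_3$ is one generated on every geometric fibre by a $3$-torsion point $Q$ (the identity, if the subgroup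 is infinitesimal there) whose $uv$-coordinates $(d,e)$ satisfy $k=\alpha e-d^2$ (equivalently $k=u(Q)u(-Q)$). The isogeny with source $C_{\alpha,\beta}$ and this kernel is the morphism to $C_{T(\alpha,\beta,k)}$ given by $$u\mapsto u(P)\,u(P-Q)\,u(P+Q),\qquad v\mapsto \frac{k^3}{\lambda}\,v(P)\,v(P-Q)\,v(P+Q),$$ where $\lambda=v(Q)v(-Q)$ and $k^3/\lambda$ denotes the element $(1+\beta k)^2$ (so the factor is $1$ where $Q$ is the identity). Let $\psi\colon C\to C'$ be this isogeny for $C$ and the parameter $\kappa$, with kernel $G$. Let $\kappa'\in S^\bullet_3$ be the parameter of the subgroup $G'=C[3]/G$ of $C'$ (whose geometric points are the images of those of $C[3]$), let $C'/G'=C_{a'',b''}$ with $(a'',b'')=T(a',b',\kappa')$, and let $\psi'\colon C'\to C'/G'$ be the isogeny above for $C'$ and the parameter $\kappa'$. Then $C$, $C'$ and $C'/G'$ are elliptic curves over $S^\bullet_3$ and $\psi$, $\kappa'$, $\psi'$ as described exist. Moreover $(u,v)\mapsto(b^{-4}u,\,b^{-12}v)$ is an isomorphism $\iota\colon C\to C'/G'$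 over $S^\bullet_3$ (the canonical isomorphism $C/C[3]\cong C'/G'$, when $C/C[3]$ is identified with $C$ so that the quotient map is $[-3]$), and $$\psi'\circ\psi=\iota\circ[-3]$$ as morphisms of schemes over $\operatorname{Spec}S^\bullet_3$. -/

import Mathlib

open CategoryTheory Limits AlgebraicGeometry Polynomial
open scoped Polynomial.Bivariate

noncomputable section

/-! ## The projective scheme of a Weierstrass curve over a commutative ring

The projective plane cubic attached to `W` is covered by the chart `Z ≠ 0`, with coordinates
`x = X / Z` and `y = Y / Z`, and the chart `Y ≠ 0`, with coordinates `u = X / Y = x / y` and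
`v = Z / Y = 1 / y`.  It is the gluing of the two charts along `y ≠ 0`, `v ≠ 0`. -/

namespace WeierstrassScheme

variable {R : Type} [CommRing R] (W : WeierstrassCurve R)

/-- The coordinate ring `R[x, y] / (y² + a₁xy + a₃y - x³ - a₂x² - a₄x - a₆)`. -/
abbrev XY : Type := W.toAffine.CoordinateRing

/-- The function `x` on the `xy`-chart. -/
def xc : XY W := AdjoinRoot.mk W.toAffine.polynomial (C X)

/-- The function `y` on the `xy`-chart. -/
def yc : XY W := AdjoinRoot.mk W.toAffine.polynomial Y

/-- The equation of the curve in the coordinates `u`, `v` (here `u` is `C X` and `v` is `Y`). -/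
def uvPolynomial : R[X][Y] :=
  Y + C (C W.a₁) * C X * Y + C (C W.a₃) * Y ^ 2
    - (C X ^ 3 + C (C W.a₂) * C X ^ 2 * Y + C (C W.a₄) * C X * Y ^ 2 + C (C W.a₆) * Y ^ 3)

/-- The coordinate ring of the chart with coordinates `u`, `v`. -/
abbrev UV : Type := AdjoinRoot (uvPolynomial W)

/-- The function `u` on the `uv`-chart. -/
def uc : UV W := AdjoinRoot.mk (uvPolynomial W) (C X)

/-- The function `v` on the `uv`-chart. -/
def vc : UV W := AdjoinRoot.mk (uvPolynomial W) Y

variable {W}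

/-- The point of the `xy`-chart with values in an `R`-algebra `T` given by a solution of the
Weierstrass equation. -/
def evalXY {T : Type} [CommRing T] [Algebra R T] (x y : T)
    (h : y ^ 2 + algebraMap R T W.a₁ * x * y + algebraMap R T W.a₃ * y =
      x ^ 3 + algebraMap R T W.a₂ * x ^ 2 + algebraMap R T W.a₄ * x + algebraMap R T W.a₆) :
    XY W →ₐ[R] T where
  __ := AdjoinRoot.lift (eval₂RingHom (algebraMap R T) x) y (by
    simp only [WeierstrassCurve.Affine.polynomial, eval₂_sub, eval₂_add, eval₂_mul, eval₂_pow,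
      eval₂_X, eval₂_C, coe_eval₂RingHom]
    linear_combination h)
  commutes' r := by
    rw [AdjoinRoot.algebraMap_eq', RingHom.comp_apply]
    simp

/-- The point of the `uv`-chart with values in an `R`-algebra `T` given by a solution of the
equation in `u`, `v`. -/
def evalUV {T : Type} [CommRing T] [Algebra R T] (u v : T)
    (h : v + algebraMap R T W.a₁ * u * v + algebraMap R T W.a₃ * v ^ 2 =
      u ^ 3 + algebraMap R T W.a₂ * u ^ 2 * v + algebraMap R T W.a₄ * u * v ^ 2
        + algebraMap R T W.a₆ * v ^ 3) :
    UV W →ₐ[R] T where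
  __ := AdjoinRoot.lift (eval₂RingHom (algebraMap R T) u) v (by
    simp only [uvPolynomial, eval₂_sub, eval₂_add, eval₂_mul, eval₂_pow,
      eval₂_X, eval₂_C, coe_eval₂RingHom]
    linear_combination h)
  commutes' r := by
    rw [AdjoinRoot.algebraMap_eq', RingHom.comp_apply]
    simp

section eval

variable {T : Type} [CommRing T] [Algebra R T]

@[simp] lemma evalXY_xc (x y : T) (h) : evalXY (W := W) x y h (xc W) = x := by
  refine Eq.trans (b := eval₂ (eval₂RingHom (algebraMap R T) x) y (C X)) rfl ?_
  simp

@[simp] lemma evalXY_yc (x y : T) (h) : evalXY (W := W) x y h (yc W) = y := by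
  refine Eq.trans (b := eval₂ (eval₂RingHom (algebraMap R T) x) y Y) rfl ?_
  simp

@[simp] lemma evalUV_uc (u v : T) (h) : evalUV (W := W) u v h (uc W) = u := by
  refine Eq.trans (b := eval₂ (eval₂RingHom (algebraMap R T) u) v (C X)) rfl ?_
  simp

@[simp] lemma evalUV_vc (u v : T) (h) : evalUV (W := W) u v h (vc W) = v := by
  refine Eq.trans (b := eval₂ (eval₂RingHom (algebraMap R T) u) v Y) rfl ?_
  simp

lemma algebraMap_adjoinRoot (f : R[X][Y]) (r : R) :
    algebraMap R (AdjoinRoot f) r = AdjoinRoot.mk f (C (C r)) := rfl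

lemma algHom_bivariate_ext {f : R[X][Y]} {φ ψ : AdjoinRoot f →ₐ[R] T}
    (h₁ : φ (AdjoinRoot.mk f (C X)) = ψ (AdjoinRoot.mk f (C X)))
    (h₂ : φ (AdjoinRoot.mk f Y) = ψ (AdjoinRoot.mk f Y)) : φ = ψ := by
  apply AlgHom.coe_ringHom_injective
  apply Ideal.Quotient.ringHom_ext
  apply Polynomial.ringHom_ext
  · intro p
    have : ((φ : AdjoinRoot f →+* T).comp ((AdjoinRoot.mk f).comp C)) =
        ((ψ : AdjoinRoot f →+* T).comp ((AdjoinRoot.mk f).comp C)) := by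
      apply Polynomial.ringHom_ext
      · intro r
        exact (φ.commutes r).trans (ψ.commutes r).symm
      · exact h₁
    exact congrArg (fun g => g p) this
  · exact h₂

end eval

variable (W)

lemma equation_xy : yc W ^ 2 + algebraMap R (XY W) W.a₁ * xc W * yc W
    + algebraMap R (XY W) W.a₃ * yc W =
    xc W ^ 3 + algebraMap R (XY W) W.a₂ * xc W ^ 2 + algebraMap R (XY W) W.a₄ * xc W
      + algebraMap R (XY W) W.a₆ := by
  have h : AdjoinRoot.mk W.toAffine.polynomial (Y ^ 2 + C (C W.a₁ * X + C W.a₃) * Y -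
    C (X ^ 3 + C W.a₂ * X ^ 2 + C W.a₄ * X + C W.a₆)) = 0 := AdjoinRoot.mk_self
  simp only [algebraMap_adjoinRoot, xc, yc]
  simp only [map_sub, map_add, map_mul, map_pow] at h ⊢
  linear_combination h

lemma equation_uv : vc W + algebraMap R (UV W) W.a₁ * uc W * vc W
    + algebraMap R (UV W) W.a₃ * vc W ^ 2 =
    uc W ^ 3 + algebraMap R (UV W) W.a₂ * uc W ^ 2 * vc W
      + algebraMap R (UV W) W.a₄ * uc W * vc W ^ 2 + algebraMap R (UV W) W.a₆ * vc W ^ 3 := by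
  have h : AdjoinRoot.mk (uvPolynomial W) (Y + C (C W.a₁) * C X * Y + C (C W.a₃) * Y ^ 2
    - (C X ^ 3 + C (C W.a₂) * C X ^ 2 * Y + C (C W.a₄) * C X * Y ^ 2 + C (C W.a₆) * Y ^ 3)) = 0 :=
    AdjoinRoot.mk_self
  simp only [algebraMap_adjoinRoot, uc, vc]
  simp only [map_sub, map_add, map_mul, map_pow] at h ⊢
  linear_combination h

/-- The overlap `y ≠ 0` of the two charts, inside the `xy`-chart. -/
abbrev XYy : Type := Localization.Away (yc W)

/-- The overlap `v ≠ 0` of the two charts, inside the `uv`-chart. -/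
abbrev UVv : Type := Localization.Away (vc W)

/-- The restriction of functions from the `uv`-chart to the overlap: `u ↦ x / y`, `v ↦ 1 / y`. -/
def uvToXYy : UV W →ₐ[R] XYy W :=
  evalUV (algebraMap (XY W) (XYy W) (xc W) * IsLocalization.Away.invSelf (yc W))
    (IsLocalization.Away.invSelf (yc W)) (by
      have e := congrArg (algebraMap (XY W) (XYy W)) (equation_xy W)
      have i := IsLocalization.Away.mul_invSelf (S := XYy W) (yc W)
      simp only [map_add, map_mul, map_pow, ← IsScalarTower.algebraMap_apply] at e
      generalize algebraMap (XY W) (XYy W) (xc W) = x at *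
      generalize algebraMap (XY W) (XYy W) (yc W) = y at *
      generalize (IsLocalization.Away.invSelf (yc W) : XYy W) = t at *
      generalize algebraMap R (XYy W) W.a₁ = a₁ at *
      generalize algebraMap R (XYy W) W.a₂ = a₂ at *
      generalize algebraMap R (XYy W) W.a₃ = a₃ at *
      generalize algebraMap R (XYy W) W.a₄ = a₄ at *
      generalize algebraMap R (XYy W) W.a₆ = a₆ at *
      linear_combination t ^ 3 * e - (t * (y * t + 1) + a₁ * x * t ^ 2 + a₃ * t ^ 2) * i)

/-- The restriction of functions from the `xy`-chart to the overlap: `x ↦ u / v`, `y ↦ 1 / v`. -/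
def xyToUVv : XY W →ₐ[R] UVv W :=
  evalXY (algebraMap (UV W) (UVv W) (uc W) * IsLocalization.Away.invSelf (vc W))
    (IsLocalization.Away.invSelf (vc W)) (by
      have e := congrArg (algebraMap (UV W) (UVv W)) (equation_uv W)
      have i := IsLocalization.Away.mul_invSelf (S := UVv W) (vc W)
      simp only [map_add, map_mul, map_pow, ← IsScalarTower.algebraMap_apply] at e
      generalize algebraMap (UV W) (UVv W) (uc W) = u at *
      generalize algebraMap (UV W) (UVv W) (vc W) = v at *
      generalize (IsLocalization.Away.invSelf (vc W) : UVv W) = t at *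
      generalize algebraMap R (UVv W) W.a₁ = a₁ at *
      generalize algebraMap R (UVv W) W.a₂ = a₂ at *
      generalize algebraMap R (UVv W) W.a₃ = a₃ at *
      generalize algebraMap R (UVv W) W.a₄ = a₄ at *
      generalize algebraMap R (UVv W) W.a₆ = a₆ at *
      linear_combination t ^ 3 * e - (t ^ 2 + a₁ * u * t ^ 2 + a₃ * t * (v * t + 1)
        - a₂ * u ^ 2 * t ^ 2 - a₄ * u * t * (v * t + 1) - a₆ * (v ^ 2 * t ^ 2 + v * t + 1)) * i)

/-- `uvToXYy`, extended to the overlap. -/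
def overlapHom : UVv W →ₐ[R] XYy W :=
  IsLocalization.liftAlgHom (M := Submonoid.powers (vc W)) (f := uvToXYy W) (by
    rintro ⟨_, n, rfl⟩
    simp only [map_pow]
    refine IsUnit.pow _ (IsUnit.of_mul_eq_one (algebraMap (XY W) (XYy W) (yc W)) ?_)
    rw [uvToXYy, evalUV_vc, mul_comm]
    exact IsLocalization.Away.mul_invSelf (yc W))

/-- `xyToUVv`, extended to the overlap. -/
def overlapInv : XYy W →ₐ[R] UVv W :=
  IsLocalization.liftAlgHom (M := Submonoid.powers (yc W)) (f := xyToUVv W) (by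
    rintro ⟨_, n, rfl⟩
    simp only [map_pow]
    refine IsUnit.pow _ (IsUnit.of_mul_eq_one (algebraMap (UV W) (UVv W) (vc W)) ?_)
    rw [xyToUVv, evalXY_yc, mul_comm]
    exact IsLocalization.Away.mul_invSelf (vc W))

lemma overlapHom_algebraMap (a : UV W) :
    overlapHom W (algebraMap (UV W) (UVv W) a) = uvToXYy W a :=
  IsLocalization.lift_eq _ _

lemma overlapInv_algebraMap (a : XY W) :
    overlapInv W (algebraMap (XY W) (XYy W) a) = xyToUVv W a :=
  IsLocalization.lift_eq _ _

lemma overlapHom_inv : overlapHom W (IsLocalization.Away.invSelf (vc W)) =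
    algebraMap (XY W) (XYy W) (yc W) := by
  have h := congrArg (overlapHom W) (IsLocalization.Away.mul_invSelf (S := UVv W) (vc W))
  have i := IsLocalization.Away.mul_invSelf (S := XYy W) (yc W)
  rw [map_mul, map_one, overlapHom_algebraMap, uvToXYy, evalUV_vc] at h
  calc _ = (algebraMap (XY W) (XYy W) (yc W) * IsLocalization.Away.invSelf (yc W)) *
      overlapHom W (IsLocalization.Away.invSelf (vc W)) := by rw [i, one_mul]
    _ = _ := by rw [mul_assoc, h, mul_one]

lemma overlapInv_inv : overlapInv W (IsLocalization.Away.invSelf (yc W)) =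
    algebraMap (UV W) (UVv W) (vc W) := by
  have h := congrArg (overlapInv W) (IsLocalization.Away.mul_invSelf (S := XYy W) (yc W))
  have i := IsLocalization.Away.mul_invSelf (S := UVv W) (vc W)
  rw [map_mul, map_one, overlapInv_algebraMap, xyToUVv, evalXY_yc] at h
  calc _ = (algebraMap (UV W) (UVv W) (vc W) * IsLocalization.Away.invSelf (vc W)) *
      overlapInv W (IsLocalization.Away.invSelf (yc W)) := by rw [i, one_mul]
    _ = _ := by rw [mul_assoc, h, mul_one]

/-- The two descriptions of the ring of functions on the overlap agree. -/
def overlapEquiv : UVv W ≃ₐ[R] XYy W :=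
  AlgEquiv.ofAlgHom (overlapHom W) (overlapInv W)
    (by
      apply IsLocalization.algHom_ext (Submonoid.powers (yc W))
      apply algHom_bivariate_ext
      · change overlapHom W (overlapInv W (algebraMap (XY W) (XYy W) (xc W))) =
          algebraMap (XY W) (XYy W) (xc W)
        rw [overlapInv_algebraMap, xyToUVv, evalXY_xc, map_mul, overlapHom_algebraMap,
          overlapHom_inv, uvToXYy, evalUV_uc, mul_assoc, mul_comm (IsLocalization.Away.invSelf _),
          IsLocalization.Away.mul_invSelf, mul_one]
      · change overlapHom W (overlapInv W (algebraMap (XY W) (XYy W) (yc W))) =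
          algebraMap (XY W) (XYy W) (yc W)
        rw [overlapInv_algebraMap, xyToUVv, evalXY_yc, overlapHom_inv])
    (by
      apply IsLocalization.algHom_ext (Submonoid.powers (vc W))
      apply algHom_bivariate_ext
      · change overlapInv W (overlapHom W (algebraMap (UV W) (UVv W) (uc W))) =
          algebraMap (UV W) (UVv W) (uc W)
        rw [overlapHom_algebraMap, uvToXYy, evalUV_uc, map_mul, overlapInv_algebraMap,
          overlapInv_inv, xyToUVv, evalXY_xc, mul_assoc, mul_comm (IsLocalization.Away.invSelf _),
          IsLocalization.Away.mul_invSelf, mul_one]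
      · change overlapInv W (overlapHom W (algebraMap (UV W) (UVv W) (vc W))) =
          algebraMap (UV W) (UVv W) (vc W)
        rw [overlapHom_algebraMap, uvToXYy, evalUV_vc, overlapInv_inv])

/-- The inclusion of the overlap into the `xy`-chart. -/
def overlapToXY : Spec (.of (XYy W)) ⟶ Spec (.of (XY W)) :=
  Spec.map (CommRingCat.ofHom (algebraMap (XY W) (XYy W)))

/-- The inclusion of the overlap into the `uv`-chart. -/
def overlapToUV : Spec (.of (XYy W)) ⟶ Spec (.of (UV W)) :=
  Spec.map (CommRingCat.ofHom (uvToXYy W : UV W →+* XYy W))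

instance : IsOpenImmersion (overlapToXY W) :=
  IsOpenImmersion.of_isLocalization (yc W)

instance : IsOpenImmersion (overlapToUV W) := by
  have h : overlapToUV W =
      Spec.map ((overlapEquiv W).toRingEquiv.toCommRingCatIso).hom ≫
        Spec.map (CommRingCat.ofHom (algebraMap (UV W) (UVv W))) := by
    rw [← Spec.map_comp, overlapToUV]
    congr 1
    exact CommRingCat.hom_ext (RingHom.ext fun a => (overlapHom_algebraMap W a).symm)
  have : IsOpenImmersion (Spec.map (CommRingCat.ofHom (algebraMap (UV W) (UVv W)))) :=
    IsOpenImmersion.of_isLocalization (vc W)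
  rw [h]
  infer_instance

/-- The projective plane cubic of the Weierstrass curve `W`, as a scheme. -/
def scheme : Scheme := pushout (overlapToXY W) (overlapToUV W)

/-- The `xy`-chart. -/
def chartXY : Spec (.of (XY W)) ⟶ scheme W := pushout.inl _ _

/-- The `uv`-chart. -/
def chartUV : Spec (.of (UV W)) ⟶ scheme W := pushout.inr _ _

/-- The structure morphism to `Spec R`. -/
def toBase : scheme W ⟶ Spec (.of R) :=
  pushout.desc (Spec.map (CommRingCat.ofHom (algebraMap R (XY W))))
    (Spec.map (CommRingCat.ofHom (algebraMap R (UV W)))) (by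
      rw [overlapToXY, overlapToUV, ← Spec.map_comp, ← Spec.map_comp]
      congr 1
      ext r
      exact (IsScalarTower.algebraMap_apply R (XY W) (XYy W) r).symm.trans
        ((uvToXYy W).commutes r).symm)

/-- The curve as an object of the category of schemes over `Spec R`. -/
def overBase : Over (Spec (.of R)) := Over.mk (toBase W)

variable {W}

open WeierstrassCurve in
/-- The morphism `Spec L ⟶ scheme W` given by a point of `W` with values in a field `L` over `R`. -/
def point {L : Type} [Field L] [Algebra R L] : (W⁄L).toAffine.Point → (Spec (.of L) ⟶ scheme W)
  | .zero => Spec.map (CommRingCat.ofHom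
      (evalUV (W := W) (0 : L) 0 (by simp) : UV W →+* L)) ≫ chartUV W
  | .some x y h => Spec.map (CommRingCat.ofHom
      (evalXY (W := W) x y ((Affine.equation_iff x y).mp h.1) : XY W →+* L)) ≫ chartXY W

end WeierstrassScheme

/-! ## The family with a point of order four -/

namespace FrobeniusSquare

open WeierstrassScheme WeierstrassCurve

/-- The curve `y² + a x y + a b y = x³ + b x²`, which in the coordinates `u = x / y`, `v = 1 / y`
is `v + a u v + a b v² = u³ + b u² v`. -/
def curve {R : Type} [CommRing R] (a b : R) : WeierstrassCurve R := ⟨a, b, a * b, 0, 0⟩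

lemma curve_Δ {R : Type} [CommRing R] (a b : R) :
    (curve a b).Δ = a ^ 2 * b ^ 4 * (a ^ 2 - 16 * b) := by
  simp only [curve, WeierstrassCurve.Δ, WeierstrassCurve.b₂, WeierstrassCurve.b₄,
    WeierstrassCurve.b₆, WeierstrassCurve.b₈]
  ring

/-! ### The base rings -/

/-- The ring `ℤ[1/4]`. -/
abbrev ZQuarter : Type := Localization.Away (4 : ℤ)

/-- `Δ = a² b⁴ (a² - 16 b)` in `ℤ[1/4][a, b]`, where `a` and `b` are the two variables. -/
def disc : MvPolynomial (Fin 2) ZQuarter :=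
  MvPolynomial.X 0 ^ 2 * MvPolynomial.X 1 ^ 4 * (MvPolynomial.X 0 ^ 2 - 16 * MvPolynomial.X 1)

/-- The ring `S = ℤ[1/4][a, b, Δ⁻¹]`. -/
abbrev S : Type := Localization.Away disc

/-- The element `a` of `S`. -/
def aS : S := algebraMap (MvPolynomial (Fin 2) ZQuarter) S (MvPolynomial.X 0)

/-- The element `b` of `S`. -/
def bS : S := algebraMap (MvPolynomial (Fin 2) ZQuarter) S (MvPolynomial.X 1)

lemma isUnit_disc : IsUnit (aS ^ 2 * bS ^ 4 * (aS ^ 2 - 16 * bS)) := by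
  have h := IsLocalization.Away.algebraMap_isUnit (S := S) disc
  simpa only [disc, aS, bS, map_mul, map_pow, map_sub, map_ofNat] using h

lemma isUnit_aS : IsUnit aS :=
  isUnit_of_dvd_unit ⟨aS * bS ^ 4 * (aS ^ 2 - 16 * bS), by ring⟩ isUnit_disc

lemma isUnit_bS : IsUnit bS :=
  isUnit_of_dvd_unit ⟨aS ^ 2 * bS ^ 3 * (aS ^ 2 - 16 * bS), by ring⟩ isUnit_disc

/-- The polynomial `κ⁴ - (6 / b²) κ² + ((a² - 8b) / b⁴) κ - 3 / b⁴` over `S`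
(`Ring.inverse` is the inverse, since `b` is a unit of `S`). -/
def polyW : S[X] :=
  X ^ 4 - C (6 * Ring.inverse (bS ^ 2)) * X ^ 2
    + C ((aS ^ 2 - 8 * bS) * Ring.inverse (bS ^ 4)) * X - C (3 * Ring.inverse (bS ^ 4))

/-- The ring `S₃ = S[κ] / (W(κ))`. -/
abbrev S₃ : Type := AdjoinRoot polyW

/-- The element `a` of `S₃`. -/
def aS₃ : S₃ := AdjoinRoot.of polyW aS

/-- The element `b` of `S₃`. -/
def bS₃ : S₃ := AdjoinRoot.of polyW bS

/-- The element `κ` of `S₃`. -/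
def κS₃ : S₃ := AdjoinRoot.root polyW

/-! ### The universal isogeny of degree three -/

section family

variable {R : Type} [CommRing R]

/-- The coefficient `a'` of the target `v + a' u v + a' b' v² = u³ + b' u² v` of the universal
isogeny (in the cases of interest `a` is a unit). -/
def targetA (a b κ : R) : R :=
  Ring.inverse a * ((a ^ 2 * b ^ 4 - 4 * b ^ 5) * κ ^ 3 + 4 * b ^ 4 * κ ^ 2
    + (-6 * a ^ 2 * b ^ 2 + 20 * b ^ 3) * κ + a ^ 4 - 12 * a ^ 2 * b + 12 * b ^ 2)

/-- The coefficient `b'` of the target of the universal isogeny. -/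
def targetB (b : R) : R := b ^ 3

section coordinates

variable {F : Type} [Field F] {E : WeierstrassCurve F}

/-- The coordinate `u = x / y` of a point, with value `0` at the identity.  It is only used at
points with `y ≠ 0`, such as all points of order three. -/
def uCoord : E.toAffine.Point → F
  | .zero => 0
  | .some x y _ => x / y

/-- The coordinate `v = 1 / y` of a point, with value `0` at the identity.  It is only used at
points with `y ≠ 0`, such as all points of order three. -/
def vCoord : E.toAffine.Point → F
  | .zero => 0
  | .some _ y _ => 1 / y

end coordinates

/-- The point `Q` of a geometric fibre generates the subgroup of order three with parameter `κ`:
it is a `3`-torsion point whose coordinates `(d, e)` satisfy `κ = a e - d²`.  (On fibres of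
characteristic three with `κ = 0` the subgroup is infinitesimal, and `Q` is the identity.) -/
def IsGenerator (a b κ : R) {L : Type} [Field L] [DecidableEq L] [Algebra R L]
    (Q : ((curve a b)⁄L).toAffine.Point) : Prop :=
  3 • Q = 0 ∧ algebraMap R L κ = algebraMap R L a * vCoord Q - uCoord Q ^ 2

/-- Let `Q = (x, y)` be a point of the curve such that `u` and `v` are finite at `Q` and at `-Q`.
Then `a v(Q) - u(Q)² = u(Q) u(-Q)`; calling this `κ`, and setting `lam = v(Q) v(-Q)`, one has
`κ³ = lam (1 + b κ)²`. Hence the factor `κ³ / lam` is `(1 + b κ)²`. -/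
lemma norm_factor {F : Type} [Field F] {a b x y : F} (h : (curve a b).toAffine.Equation x y)
    (hy : y ≠ 0) (hy' : (curve a b).toAffine.negY x y ≠ 0) :
    a * (1 / y) - (x / y) ^ 2 = x / y * (x / (curve a b).toAffine.negY x y) ∧
    (x / y * (x / (curve a b).toAffine.negY x y)) ^ 3 =
      1 / y * (1 / (curve a b).toAffine.negY x y) *
        (1 + b * (x / y * (x / (curve a b).toAffine.negY x y))) ^ 2 := by
  rw [WeierstrassCurve.Affine.equation_iff] at h
  simp only [WeierstrassCurve.Affine.negY, curve] at h hy' ⊢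
  set z := -y - a * x - a * b with hz
  have hyz : y * z = -(x ^ 2 * (x + b)) := by rw [hz]; linear_combination -h
  have hzz : (a * y - x ^ 2) * z = x ^ 2 * y := by rw [hz]; linear_combination -a * h
  have hs : y * z + b * x ^ 2 = -x ^ 3 := by rw [hyz]; ring
  constructor
  · field_simp
    linear_combination hzz
  · have e : 1 + b * (x / y * (x / z)) = (y * z + b * x ^ 2) / (y * z) := by field_simp
    rw [e, hs]
    field_simp

/-- `ψ` is the isogeny over `Spec R` from the curve with coefficients `a`, `b` whose kernel is the
subgroup of order three with parameter `κ`, and which is given by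
`u(ψ(P)) = u(P) u(P - Q) u(P + Q)` and `v(ψ(P)) = (κ³ / lam) v(P) v(P - Q) v(P + Q)`,
where `Q` generates the kernel and `κ³ / lam = (1 + b κ)²` as in `norm_factor`.
In terms of `x = u / v` and `y = 1 / v` this says that `ψ(P)` is the identity for
`P ∈ {0, Q, -Q}`, and otherwise has as coordinates the products of the three values of `x`,
respectively `y`, divided by `(1 + b κ)²`. -/
def IsUniversalIsogeny (a b κ : R) {E : WeierstrassCurve R}
    (ψ : overBase (curve a b) ⟶ overBase E) : Prop :=
  ∀ (L : Type) [Field L] [DecidableEq L] [IsAlgClosed L] [Algebra R L]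
    (Q P : ((curve a b)⁄L).toAffine.Point), IsGenerator a b κ Q →
    ((P = 0 ∨ P = Q ∨ P = -Q) → point P ≫ ψ.left = point (0 : (E⁄L).toAffine.Point)) ∧
    ∀ (x₀ y₀ x₁ y₁ x₂ y₂ : L) (h₀) (h₁) (h₂),
      P = .some x₀ y₀ h₀ → P - Q = .some x₁ y₁ h₁ → P + Q = .some x₂ y₂ h₂ →
      ∃ h, point P ≫ ψ.left = point (W := E) (L := L)
        (.some (x₀ * x₁ * x₂ / (1 + algebraMap R L b * algebraMap R L κ) ^ 2)
          (y₀ * y₁ * y₂ / (1 + algebraMap R L b * algebraMap R L κ) ^ 2) h)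

/-- `κ'` is the parameter of the subgroup `G' = C[3] / G` of the target of the isogeny `ψ` with
source `C` and kernel `G`: on each geometric fibre the generators of the subgroup with parameter
`κ'` are the points which generate the image of the `3`-torsion under `ψ`. -/
def IsQuotientParameter {E : WeierstrassCurve R} (a' b' κ' : R)
    (ψ : overBase E ⟶ overBase (curve a' b')) : Prop :=
  ∀ (L : Type) [Field L] [DecidableEq L] [IsAlgClosed L] [Algebra R L]
    (Q : ((curve a' b')⁄L).toAffine.Point),
    IsGenerator a' b' κ' Q ↔
      (AddSubgroup.zmultiples Q : Set ((curve a' b')⁄L).toAffine.Point) =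
        {T' | ∃ T : (E⁄L).toAffine.Point, 3 • T = 0 ∧ point T ≫ ψ.left = point T'}

/-- `m` is multiplication by the integer `n`. -/
def IsMultiplicationBy (n : ℤ) {E : WeierstrassCurve R} (m : overBase E ⟶ overBase E) : Prop :=
  ∀ (L : Type) [Field L] [DecidableEq L] [IsAlgClosed L] [Algebra R L]
    (P : (E⁄L).toAffine.Point), point P ≫ m.left = point (n • P)

/-- `ι` is the change of coordinates `(x, y) ↦ (t⁻² x, t⁻³ y)`, that is `(u, v) ↦ (t u, t³ v)`. -/
def IsScaling (t : R) {E E' : WeierstrassCurve R} (ι : overBase E ⟶ overBase E') : Prop :=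
  ∀ (L : Type) [Field L] [DecidableEq L] [IsAlgClosed L] [Algebra R L],
    point (0 : (E⁄L).toAffine.Point) ≫ ι.left = point (0 : (E'⁄L).toAffine.Point) ∧
    ∀ (x y : L) (h), ∃ h', point (W := E) (L := L) (.some x y h) ≫ ι.left =
      point (W := E') (L := L) (.some ((algebraMap R L t)⁻¹ ^ 2 * x) ((algebraMap R L t)⁻¹ ^ 3 * y) h')

end family

/-- The coefficient `a'` of `C'`. -/
def aS₃' : S₃ := targetA aS₃ bS₃ κS₃

/-- The coefficient `b'` of `C'`. -/
def bS₃' : S₃ := targetB bS₃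

/-- The curve `C` over `S₃`. -/
abbrev curveC : WeierstrassCurve S₃ := curve aS₃ bS₃

/-- The curve `C' = C / G` over `S₃`. -/
abbrev curveC' : WeierstrassCurve S₃ := curve aS₃' bS₃'

/-- The curve `C' / G'` over `S₃`, where `G'` is the subgroup of `C'` with parameter `κ'`. -/
abbrev curveC'' (κ' : S₃) : WeierstrassCurve S₃ := curve (targetA aS₃' bS₃' κ') (targetB bS₃')

end FrobeniusSquare

end

open FrobeniusSquare WeierstrassScheme

/-! Put w = 1 + bκ and w' = 1 + b³κ'. The equation W(κ) = 0 becomes (w - 1)(w' - 1) = -3, that is w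
+ w' - ww' = 4, and it also gives a² = -b w³ w'. With k = a/w this reads k² = -b w w'; moreover a² -
16b = b(w - 2)³(w' - 2), and the target has coefficients a' = -b w' k and b' = b³. So passing from C
to C' replaces (b, k, w, w') by (b³, -bk, w', w): the dual isogeny is another instance of the same
construction, and two steps turn (a, b) into (b⁴a, b⁸b), which is the scaling ι. This symmetry is
`Admissible` together with `Admissible.dual`, and `admissible_S₃` supplies the universal instance.

The isogeny is written as (`numX`/`den`², `numY`/`den`³), where `den` = w + κx vanishes at ±Q. These
formulas still make sense where κ = 0 and Q is the identity. They land on the target by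
`num_equation`, they have no common zero by `numY_ne_zero`, and `exists_isogeny` glues them to a
morphism. `isogeny_eq_product` recovers the product over P, P - Q, P + Q from the sum and the
product of the slopes of the lines joining P to ±Q; fibres with κ = 0 have characteristic three, and
there the formulas cube the coordinates.

For the composite, `composite_coordinates` shows that the total denominator is, up to a power of b,
minus the third division polynomial, and that the coordinates are those of -3P found in
`neg_three_smul`. The y-coordinates are compared through the odd function 2y + ax + ab: it
determines y since 2 is invertible, and ψ multiplies it by a function of x (`numY_add_numY`). The
identity of denominators, with surjectivity of ψ on geometric points, also shows that κ' is the
parameter of C[3]/G. Taking m = ι⁻¹ ∘ ψ' ∘ ψ, it remains to see that m acts as -3 on geometric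
points, which is `point_comp_comp`. -/

noncomputable section

/-! ### Points with values in algebras, and homogeneous coordinates of a morphism -/

namespace WeierstrassScheme

variable {R : Type} [CommRing R] {W : WeierstrassCurve R}

/-- The affine Weierstrass equation, over an `R`-algebra. -/
abbrev EqXY (W : WeierstrassCurve R) {T : Type} [CommRing T] [Algebra R T] (x y : T) : Prop :=
  y ^ 2 + algebraMap R T W.a₁ * x * y + algebraMap R T W.a₃ * y =
      x ^ 3 + algebraMap R T W.a₂ * x ^ 2 + algebraMap R T W.a₄ * x + algebraMap R T W.a₆

/-- The Weierstrass equation in the coordinates `u`, `v`, over an `R`-algebra. -/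
abbrev EqUV (W : WeierstrassCurve R) {T : Type} [CommRing T] [Algebra R T] (u v : T) : Prop :=
  v + algebraMap R T W.a₁ * u * v + algebraMap R T W.a₃ * v ^ 2 =
      u ^ 3 + algebraMap R T W.a₂ * u ^ 2 * v + algebraMap R T W.a₄ * u * v ^ 2
        + algebraMap R T W.a₆ * v ^ 3

/-- The homogeneous Weierstrass equation, over an `R`-algebra. -/
abbrev EqHom (W : WeierstrassCurve R) {T : Type} [CommRing T] [Algebra R T] (p q r : T) : Prop :=
  q ^ 2 * r + algebraMap R T W.a₁ * p * q * r + algebraMap R T W.a₃ * q * r ^ 2 =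
      p ^ 3 + algebraMap R T W.a₂ * p ^ 2 * r + algebraMap R T W.a₄ * p * r ^ 2
        + algebraMap R T W.a₆ * r ^ 3

/-- The map on spectra of a ring homomorphism. -/
abbrev specMap {A B : Type} [CommRing A] [CommRing B] (f : A →+* B) :
    Spec (.of B) ⟶ Spec (.of A) := Spec.map (CommRingCat.ofHom f)

lemma specMap_comp {A B D : Type} [CommRing A] [CommRing B] [CommRing D] (f : A →+* B)
    (g : B →+* D) : specMap (g.comp f) = specMap g ≫ specMap f := by
  rw [← Spec.map_comp, ← CommRingCat.ofHom_comp]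

section points

variable {T : Type} [CommRing T] [Algebra R T]

/-- The morphism from `Spec T` to the curve given by a solution of the affine equation. -/
def ptXY (x y : T) (h : EqXY W x y) : Spec (.of T) ⟶ scheme W :=
  specMap (evalXY x y h : XY W →+* T) ≫ chartXY W

/-- The morphism from `Spec T` to the curve given by a solution of the equation in `u`, `v`. -/
def ptUV (u v : T) (h : EqUV W u v) : Spec (.of T) ⟶ scheme W :=
  specMap (evalUV u v h : UV W →+* T) ≫ chartUV W

lemma chartXY_toBase : chartXY W ≫ toBase W = specMap (algebraMap R (XY W)) :=
  pushout.inl_desc _ _ _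

lemma chartUV_toBase : chartUV W ≫ toBase W = specMap (algebraMap R (UV W)) :=
  pushout.inr_desc _ _ _

lemma ptXY_toBase (x y : T) (h : EqXY W x y) :
    ptXY x y h ≫ toBase W = specMap (algebraMap R T) := by
  rw [ptXY, Category.assoc, chartXY_toBase, ← specMap_comp, AlgHom.comp_algebraMap]

lemma ptUV_toBase (u v : T) (h : EqUV W u v) :
    ptUV u v h ≫ toBase W = specMap (algebraMap R T) := by
  rw [ptUV, Category.assoc, chartUV_toBase, ← specMap_comp, AlgHom.comp_algebraMap]

/-- As y is invertible with inverse v, evaluation at (x, y) extends to the localization at y, and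
the extension takes x/y and 1/y to u and v. -/
lemma exists_overlap_hom {x y u v : T} (h : EqXY W x y) (h' : EqUV W u v) (hy : y * v = 1)
    (hu : u = x * v) : ∃ φ : XYy W →+* T, (evalXY x y h : XY W →+* T) = φ.comp (algebraMap _ _) ∧
      (evalUV u v h' : UV W →+* T) = φ.comp (uvToXYy W : UV W →+* XYy W) := by
  have hyu : IsUnit (evalXY x y h (yc W)) := by
    rw [evalXY_yc]; exact IsUnit.of_mul_eq_one v hy
  obtain ⟨φ, h1⟩ : ∃ φ : XYy W →+* T, (evalXY x y h : XY W →+* T) = φ.comp (algebraMap _ _) :=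
    ⟨_, (IsLocalization.Away.lift_comp (S := XYy W) (yc W) hyu).symm⟩
  have hc : ∀ z, φ (algebraMap _ _ z) = evalXY x y h z := fun z =>
    (congrArg (fun f : XY W →+* T => f z) h1).symm
  have hinv : φ (IsLocalization.Away.invSelf (yc W)) = v := by
    have := congrArg φ (IsLocalization.Away.mul_invSelf (S := XYy W) (yc W))
    rw [map_mul, map_one, hc, evalXY_yc] at this
    linear_combination v * this - φ (IsLocalization.Away.invSelf (yc W)) * hy
  obtain ⟨ψ, hψ⟩ : ∃ ψ : XYy W →ₐ[R] T, (ψ : XYy W →+* T) = φ := ⟨{ φ with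
    commutes' := fun r => by
      change φ (algebraMap R (XYy W) r) = _
      rw [IsScalarTower.algebraMap_apply R (XY W) (XYy W), hc, AlgHom.commutes] }, rfl⟩
  refine ⟨φ, h1, ?_⟩
  have h2 : evalUV u v h' = ψ.comp (uvToXYy W) := by
    apply algHom_bivariate_ext
    · change evalUV u v h' (uc W) = (ψ : XYy W →+* T) (uvToXYy W (uc W))
      rw [hψ, evalUV_uc, uvToXYy, evalUV_uc, map_mul, hc, evalXY_xc, hinv, hu]
    · change evalUV u v h' (vc W) = (ψ : XYy W →+* T) (uvToXYy W (vc W))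
      rw [hψ, evalUV_vc, uvToXYy, evalUV_vc, hinv]
  rw [h2, ← hψ]
  rfl

lemma overlap_condition : specMap (algebraMap (XY W) (XYy W)) ≫ chartXY W =
    specMap (uvToXYy W : UV W →+* XYy W) ≫ chartUV W :=
  pushout.condition (f := overlapToXY W) (g := overlapToUV W)

lemma ptXY_eq_ptUV {x y u v : T} (h : EqXY W x y) (h' : EqUV W u v) (hy : y * v = 1)
    (hu : u = x * v) : ptXY x y h = ptUV u v h' := by
  obtain ⟨φ, h1, h2⟩ := exists_overlap_hom h h' hy hu
  rw [ptXY, ptUV, h1, h2, specMap_comp (algebraMap (XY W) (XYy W)) φ,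
    specMap_comp (uvToXYy W : UV W →+* XYy W) φ, Category.assoc, Category.assoc,
    overlap_condition]

lemma EqXY.map {T' : Type} [CommRing T'] [Algebra R T'] (φ : T →ₐ[R] T') {x y : T}
    (h : EqXY W x y) : EqXY W (φ x) (φ y) := by
  have := congrArg φ h
  simpa only [EqXY, map_add, map_mul, map_pow, AlgHom.commutes] using this

lemma EqUV.map {T' : Type} [CommRing T'] [Algebra R T'] (φ : T →ₐ[R] T') {x y : T}
    (h : EqUV W x y) : EqUV W (φ x) (φ y) := by
  have := congrArg φ h
  simpa only [EqUV, map_add, map_mul, map_pow, AlgHom.commutes] using this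

lemma EqHom.map {T' : Type} [CommRing T'] [Algebra R T'] (φ : T →ₐ[R] T') {x y z : T}
    (h : EqHom W x y z) : EqHom W (φ x) (φ y) (φ z) := by
  have := congrArg φ h
  simpa only [EqHom, map_add, map_mul, map_pow, AlgHom.commutes] using this

lemma specMap_ptXY {T' : Type} [CommRing T'] [Algebra R T'] (φ : T →ₐ[R] T') {x y : T}
    (h : EqXY W x y) : specMap (φ : T →+* T') ≫ ptXY x y h = ptXY (φ x) (φ y) (h.map φ) := by
  rw [ptXY, ptXY, ← Category.assoc, ← specMap_comp]
  congr 3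
  have : φ.comp (evalXY x y h) = evalXY (φ x) (φ y) (h.map φ) := by
    apply algHom_bivariate_ext
    · change φ (evalXY x y h (xc W)) = evalXY _ _ _ (xc W)
      simp
    · change φ (evalXY x y h (yc W)) = evalXY _ _ _ (yc W)
      simp
  rw [← this]; rfl

lemma specMap_ptUV {T' : Type} [CommRing T'] [Algebra R T'] (φ : T →ₐ[R] T') {x y : T}
    (h : EqUV W x y) : specMap (φ : T →+* T') ≫ ptUV x y h = ptUV (φ x) (φ y) (h.map φ) := by
  rw [ptUV, ptUV, ← Category.assoc, ← specMap_comp]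
  congr 3
  have : φ.comp (evalUV x y h) = evalUV (φ x) (φ y) (h.map φ) := by
    apply algHom_bivariate_ext
    · change φ (evalUV x y h (uc W)) = evalUV _ _ _ (uc W)
      simp
    · change φ (evalUV x y h (vc W)) = evalUV _ _ _ (vc W)
      simp
  rw [← this]; rfl

lemma chartXY_eq_ptXY : chartXY W = ptXY (xc W) (yc W) (equation_xy W) := by
  have : evalXY (xc W) (yc W) (equation_xy W) = AlgHom.id R (XY W) := by
    apply algHom_bivariate_ext
    · exact evalXY_xc _ _ _
    · exact evalXY_yc _ _ _
  rw [ptXY, this]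
  exact (Category.id_comp _).symm.trans (congrArg (· ≫ chartXY W) (Spec.map_id _).symm)

lemma chartUV_eq_ptUV : chartUV W = ptUV (uc W) (vc W) (equation_uv W) := by
  have : evalUV (uc W) (vc W) (equation_uv W) = AlgHom.id R (UV W) := by
    apply algHom_bivariate_ext
    · exact evalUV_uc _ _ _
    · exact evalUV_vc _ _ _
  rw [ptUV, this]
  exact (Category.id_comp _).symm.trans (congrArg (· ≫ chartUV W) (Spec.map_id _).symm)

lemma EqHom.eqXY {p q r s : T} (h : EqHom W p q r) (hs : r * s = 1) : EqXY W (p * s) (q * s) := by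
  unfold EqHom at h
  unfold EqXY
  linear_combination s ^ 3 * h - (q ^ 2 * s ^ 2 + algebraMap R T W.a₁ * p * q * s ^ 2 +
    algebraMap R T W.a₃ * q * s * (r * s + 1) - algebraMap R T W.a₂ * p ^ 2 * s ^ 2
    - algebraMap R T W.a₄ * p * s * (r * s + 1)
    - algebraMap R T W.a₆ * ((r * s) ^ 2 + r * s + 1)) * hs

lemma EqHom.eqUV {p q r s : T} (h : EqHom W p q r) (hs : q * s = 1) : EqUV W (p * s) (r * s) := by
  unfold EqHom at h
  unfold EqUV
  linear_combination s ^ 3 * h - (r * s * (q * s + 1) + algebraMap R T W.a₁ * p * r * s ^ 2 +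
    algebraMap R T W.a₃ * r ^ 2 * s ^ 2) * hs

/-- The morphism `f` is given by the homogeneous coordinates `p`, `q`, `r`. -/
structure Represents (f : Spec (.of T) ⟶ scheme W) (p q r : T) : Prop where
  xy : ∀ {A : Type} [CommRing A] [Algebra R A] (φ : T →ₐ[R] A) (x y : A) (h : EqXY W x y),
    φ r * x = φ p → φ r * y = φ q → IsUnit (φ r) → specMap (φ : T →+* A) ≫ f = ptXY x y h
  uv : ∀ {A : Type} [CommRing A] [Algebra R A] (φ : T →ₐ[R] A) (u v : A) (h : EqUV W u v),
    φ q * u = φ p → φ q * v = φ r → IsUnit (φ q) → specMap (φ : T →+* A) ≫ f = ptUV u v h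

lemma Represents.comp {f : Spec (.of T) ⟶ scheme W} {p q r : T} (hf : Represents f p q r)
    {A : Type} [CommRing A] [Algebra R A] (φ : T →ₐ[R] A) :
    Represents (specMap (φ : T →+* A) ≫ f) (φ p) (φ q) (φ r) where
  xy χ x y h h1 h2 h3 := by
    rw [← Category.assoc, ← specMap_comp]
    exact hf.xy (χ.comp φ) x y h h1 h2 h3
  uv χ x y h h1 h2 h3 := by
    rw [← Category.assoc, ← specMap_comp]
    exact hf.uv (χ.comp φ) x y h h1 h2 h3

lemma Represents.smul {f : Spec (.of T) ⟶ scheme W} {p q r c : T}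
    (hf : Represents f (c * p) (c * q) (c * r)) (hc : IsUnit c) : Represents f p q r where
  xy χ x y h h1 h2 h3 := by
    refine hf.xy χ x y h ?_ ?_ ?_ <;> rw [map_mul]
    · rw [map_mul, mul_assoc, h1]
    · rw [map_mul, mul_assoc, h2]
    · exact (hc.map χ).mul h3
  uv χ x y h h1 h2 h3 := by
    refine hf.uv χ x y h ?_ ?_ ?_ <;> rw [map_mul]
    · rw [map_mul, mul_assoc, h1]
    · rw [map_mul, mul_assoc, h2]
    · exact (hc.map χ).mul h3

/-- Two elements generating the unit ideal give a cover by the loci where they are invertible. -/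
def coverOfTwo (q r : T) (h : Ideal.span {q, r} = ⊤) : (Spec (.of T)).OpenCover :=
  (Scheme.affineOpenCoverOfSpanRangeEqTop (R := .of T) (fun i : Bool => bif i then q else r) (by
    rw [← h]; congr 1; ext z; simp [eq_comm, or_comm])).openCover

lemma hom_ext_coverOfTwo {Z : Scheme} {q r : T} (h : Ideal.span {q, r} = ⊤)
    {f g : Spec (.of T) ⟶ Z}
    (hq : specMap (algebraMap T (Localization.Away q)) ≫ f =
      specMap (algebraMap T (Localization.Away q)) ≫ g)
    (hr : specMap (algebraMap T (Localization.Away r)) ≫ f =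
      specMap (algebraMap T (Localization.Away r)) ≫ g) : f = g := by
  apply (coverOfTwo q r h).hom_ext
  rintro (_ | _)
  · exact hr
  · exact hq

/-- The coordinates determine a morphism where q or r is invertible, and these loci cover. The
coordinate p may be left out of the ideal, because on the cubic r = 0 forces p³ = 0. -/
lemma Represents.unique {f g : Spec (.of T) ⟶ scheme W} {p q r : T} (hf : Represents f p q r)
    (hg : Represents g p q r) (e : EqHom W p q r) (h : Ideal.span {q, r} = ⊤) : f = g := by
  apply hom_ext_coverOfTwo h
  · let φ : T →ₐ[R] Localization.Away q := IsScalarTower.toAlgHom R T _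
    have hu : IsUnit (φ q) := IsLocalization.Away.algebraMap_isUnit q
    obtain ⟨s, hs⟩ := hu.exists_right_inv
    have e' := (e.map φ).eqUV hs
    exact (hf.uv φ _ _ e' (by rw [mul_left_comm, hs, mul_one]) (by rw [mul_left_comm, hs, mul_one])
      hu).trans (hg.uv φ _ _ e' (by rw [mul_left_comm, hs, mul_one])
        (by rw [mul_left_comm, hs, mul_one]) hu).symm
  · let φ : T →ₐ[R] Localization.Away r := IsScalarTower.toAlgHom R T _
    have hu : IsUnit (φ r) := IsLocalization.Away.algebraMap_isUnit r
    obtain ⟨s, hs⟩ := hu.exists_right_inv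
    have e' := (e.map φ).eqXY hs
    exact (hf.xy φ _ _ e' (by rw [mul_left_comm, hs, mul_one]) (by rw [mul_left_comm, hs, mul_one])
      hu).trans (hg.xy φ _ _ e' (by rw [mul_left_comm, hs, mul_one])
        (by rw [mul_left_comm, hs, mul_one]) hu).symm

end points

end WeierstrassScheme

/-! ### Existence of morphisms with prescribed homogeneous coordinates -/

namespace WeierstrassScheme

variable {R : Type} [CommRing R] {W : WeierstrassCurve R}

section points

variable {T : Type} [CommRing T] [Algebra R T]

lemma ptXY_congr {x y x' y' : T} (h : EqXY W x y) (h' : EqXY W x' y') (hx : x = x') (hy : y = y') :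
    ptXY x y h = ptXY x' y' h' := by
  subst hx hy; rfl

lemma ptUV_congr {x y x' y' : T} (h : EqUV W x y) (h' : EqUV W x' y') (hx : x = x') (hy : y = y') :
    ptUV x y h = ptUV x' y' h' := by
  subst hx hy; rfl

/-- Where q and r are both invertible, (p/r, q/r) and (p/q, r/q) are the same point in the two
charts; this is the compatibility needed for gluing. -/
lemma EqHom.overlap {A B D : Type} [CommRing A] [CommRing B] [CommRing D] [Algebra R A]
    [Algebra R B] [Algebra R D] (α : A →ₐ[R] D) (β : B →ₐ[R] D) (τ : T →ₐ[R] A) (σ : T →ₐ[R] B)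
    (hc : α.comp τ = β.comp σ) {p q r : T} (e : EqHom W p q r) {s : A} {t : B}
    (hs : τ r * s = 1) (ht : σ q * t = 1) :
    specMap (α : A →+* D) ≫ ptXY _ _ ((e.map τ).eqXY hs) =
      specMap (β : B →+* D) ≫ ptUV _ _ ((e.map σ).eqUV ht) := by
  rw [specMap_ptXY, specMap_ptUV]
  have hcc : ∀ z, β (σ z) = α (τ z) := fun z => (congrArg (fun f : T →ₐ[R] D => f z) hc).symm
  have hs' := congrArg α hs
  have ht' := congrArg β ht
  rw [map_mul, map_one] at hs' ht'
  rw [hcc] at ht'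
  apply ptXY_eq_ptUV
  · rw [map_mul, map_mul, hcc]
    linear_combination hs' * (α (τ q) * β t) + ht'
  · rw [map_mul, map_mul, map_mul, hcc, hcc]
    linear_combination -hs' * (α (τ p) * β t)

lemma exists_represents {p q r : T} (e : EqHom W p q r) (h : Ideal.span {q, r} = ⊤) :
    ∃ f : Spec (.of T) ⟶ scheme W, Represents f p q r ∧
      f ≫ toBase W = specMap (algebraMap R T) := by
  let τ : T →ₐ[R] Localization.Away r := IsScalarTower.toAlgHom R T _
  let σ : T →ₐ[R] Localization.Away q := IsScalarTower.toAlgHom R T _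
  have hr : τ r * IsLocalization.Away.invSelf r = 1 := IsLocalization.Away.mul_invSelf r
  have hq : σ q * IsLocalization.Away.invSelf q = 1 := IsLocalization.Away.mul_invSelf q
  have hov : pullback.fst (specMap (algebraMap T (Localization.Away r)))
        (specMap (algebraMap T (Localization.Away q))) ≫ ptXY _ _ ((e.map τ).eqXY hr) =
      pullback.snd (specMap (algebraMap T (Localization.Away r)))
        (specMap (algebraMap T (Localization.Away q))) ≫ ptUV _ _ ((e.map σ).eqUV hq) := by
    rw [← cancel_epi (pullbackSpecIso T (Localization.Away r) (Localization.Away q)).inv,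
      ← Category.assoc, ← Category.assoc]
    erw [pullbackSpecIso_inv_fst, pullbackSpecIso_inv_snd]
    let α : Localization.Away r →ₐ[R] TensorProduct T (Localization.Away r) (Localization.Away q) :=
      Algebra.TensorProduct.includeLeft
    let β : Localization.Away q →ₐ[R] TensorProduct T (Localization.Away r) (Localization.Away q) :=
      (Algebra.TensorProduct.includeRight (R := T) (A := Localization.Away r)
        (B := Localization.Away q)).restrictScalars R
    refine EqHom.overlap α β τ σ ?_ e hr hq
    ext z
    exact (Algebra.TensorProduct.includeLeft (R := T) (S := T) (A := Localization.Away r)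
        (B := Localization.Away q)).commutes z |>.trans
      ((Algebra.TensorProduct.includeRight (R := T) (A := Localization.Away r)
        (B := Localization.Away q)).commutes z).symm
  let F : ∀ i : (coverOfTwo q r h).I₀, (coverOfTwo q r h).X i ⟶ scheme W := fun i =>
    match i with
    | true => ptUV _ _ ((e.map σ).eqUV hq)
    | false => ptXY _ _ ((e.map τ).eqXY hr)
  have hF : ∀ i j, pullback.fst ((coverOfTwo q r h).f i) ((coverOfTwo q r h).f j) ≫ F i =
      pullback.snd ((coverOfTwo q r h).f i) ((coverOfTwo q r h).f j) ≫ F j := by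
    -- Members of the cover are monomorphisms, so the two projections from a self-intersection
    -- coincide.
    have hdiag : ∀ i, pullback.fst ((coverOfTwo q r h).f i) ((coverOfTwo q r h).f i) ≫ F i =
      pullback.snd ((coverOfTwo q r h).f i) ((coverOfTwo q r h).f i) ≫ F i := fun i => by
      congr 1
      rw [← cancel_mono ((coverOfTwo q r h).f i)]
      exact pullback.condition
    rintro (_ | _) (_ | _)
    · exact hdiag _
    · exact hov
    · rw [← cancel_epi (pullbackSymmetry _ _).hom, ← Category.assoc, ← Category.assoc,
        pullbackSymmetry_hom_comp_fst, pullbackSymmetry_hom_comp_snd]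
      exact hov.symm
    · exact hdiag _
  have hfr : specMap (algebraMap T (Localization.Away r)) ≫
      (coverOfTwo q r h).glueMorphisms F hF = ptXY _ _ ((e.map τ).eqXY hr) :=
    Scheme.Cover.ι_glueMorphisms (coverOfTwo q r h) F hF false
  have hfq : specMap (algebraMap T (Localization.Away q)) ≫
      (coverOfTwo q r h).glueMorphisms F hF = ptUV _ _ ((e.map σ).eqUV hq) :=
    Scheme.Cover.ι_glueMorphisms (coverOfTwo q r h) F hF true
  refine ⟨(coverOfTwo q r h).glueMorphisms F hF, ⟨?_, ?_⟩, ?_⟩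
  · intro A _ _ φ x y hxy h1 h2 h3
    -- Since φ inverts r, it factors through the localization, where the glued morphism is known.
    have hφ : φ = (IsLocalization.liftAlgHom (M := Submonoid.powers r) (S := Localization.Away r)
        (f := φ) (by rintro ⟨_, n, rfl⟩; rw [map_pow]; exact h3.pow n)).comp τ := by
      ext z; exact (IsLocalization.lift_eq _ _).symm
    generalize (IsLocalization.liftAlgHom (M := Submonoid.powers r) (S := Localization.Away r)
        (f := φ) (by rintro ⟨_, n, rfl⟩; rw [map_pow]; exact h3.pow n)) = χ at hφ
    subst hφ
    have hr' := congrArg χ hr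
    rw [map_mul, map_one] at hr'
    change χ (τ r) * x = χ (τ p) at h1
    change χ (τ r) * y = χ (τ q) at h2
    have : specMap ((χ.comp τ : T →ₐ[R] A) : T →+* A) =
        specMap (χ : _ →+* A) ≫ specMap (algebraMap T (Localization.Away r)) :=
      specMap_comp _ _
    rw [this, Category.assoc, hfr, specMap_ptXY]
    apply ptXY_congr
    · rw [map_mul, ← h1]; linear_combination x * hr'
    · rw [map_mul, ← h2]; linear_combination y * hr'
  · intro A _ _ φ x y hxy h1 h2 h3
    have hφ : φ = (IsLocalization.liftAlgHom (M := Submonoid.powers q) (S := Localization.Away q)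
        (f := φ) (by rintro ⟨_, n, rfl⟩; rw [map_pow]; exact h3.pow n)).comp σ := by
      ext z; exact (IsLocalization.lift_eq _ _).symm
    generalize (IsLocalization.liftAlgHom (M := Submonoid.powers q) (S := Localization.Away q)
        (f := φ) (by rintro ⟨_, n, rfl⟩; rw [map_pow]; exact h3.pow n)) = χ at hφ
    subst hφ
    have hr' := congrArg χ hq
    rw [map_mul, map_one] at hr'
    change χ (σ q) * x = χ (σ p) at h1
    change χ (σ q) * y = χ (σ r) at h2
    have : specMap ((χ.comp σ : T →ₐ[R] A) : T →+* A) =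
        specMap (χ : _ →+* A) ≫ specMap (algebraMap T (Localization.Away q)) :=
      specMap_comp _ _
    rw [this, Category.assoc, hfq, specMap_ptUV]
    apply ptUV_congr
    · rw [map_mul, ← h1]; linear_combination x * hr'
    · rw [map_mul, ← h2]; linear_combination y * hr'
  · apply hom_ext_coverOfTwo h
    · rw [← Category.assoc, hfq, ptUV_toBase, ← specMap_comp,
        ← IsScalarTower.algebraMap_eq]
    · rw [← Category.assoc, hfr, ptXY_toBase, ← specMap_comp,
        ← IsScalarTower.algebraMap_eq]

end points

/-- A morphism to the curve `W'` given by homogeneous coordinates on the two charts of `W`. -/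
lemma exists_hom {W' : WeierstrassCurve R} {p q r : XY W} {p' q' r' : UV W}
    (e : EqHom W' p q r) (h : Ideal.span {q, r} = ⊤) (e' : EqHom W' p' q' r')
    (h' : Ideal.span {q', r'} = ⊤) (c : XYy W) (hc : IsUnit c)
    (hp : uvToXYy W p' = c * algebraMap _ _ p) (hq : uvToXYy W q' = c * algebraMap _ _ q)
    (hr : uvToXYy W r' = c * algebraMap _ _ r) :
    ∃ f : overBase W ⟶ overBase W', Represents (chartXY W ≫ f.left) p q r ∧
      Represents (chartUV W ≫ f.left) p' q' r' := by
  obtain ⟨f, hf, hfb⟩ := exists_represents e h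
  obtain ⟨g, hg, hgb⟩ := exists_represents e' h'
  -- On the overlap the two triples differ by the unit c, so they represent the same morphism.
  have hcomp : overlapToXY W ≫ f = overlapToUV W ≫ g := by
    let τ : XY W →ₐ[R] XYy W := IsScalarTower.toAlgHom R _ _
    have h1 : Represents (overlapToXY W ≫ f) (τ p) (τ q) (τ r) := hf.comp τ
    have h2 : Represents (overlapToUV W ≫ g) (uvToXYy W p') (uvToXYy W q') (uvToXYy W r') :=
      hg.comp (uvToXYy W)
    rw [hp, hq, hr] at h2
    refine h1.unique (h2.smul hc) (e.map τ) ?_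
    have := congrArg (Ideal.map (τ : XY W →+* XYy W)) h
    rwa [Ideal.map_span, Ideal.map_top, Set.image_pair] at this
  have hb : pushout.desc f g hcomp ≫ toBase W' = toBase W := by
    apply pushout.hom_ext
    · rw [pushout.inl_desc_assoc, hfb]; exact chartXY_toBase.symm
    · rw [pushout.inr_desc_assoc, hgb]; exact chartUV_toBase.symm
  refine ⟨Over.homMk (pushout.desc f g hcomp) hb, ?_, ?_⟩
  · have : chartXY W ≫ pushout.desc f g hcomp = f := pushout.inl_desc _ _ _
    change Represents (chartXY W ≫ pushout.desc f g hcomp) p q r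
    rwa [this]
  · have : chartUV W ≫ pushout.desc f g hcomp = g := pushout.inr_desc _ _ _
    change Represents (chartUV W ≫ pushout.desc f g hcomp) p' q' r'
    rwa [this]

lemma hom_ext {Z : Over (Spec (.of R))} {f g : overBase W ⟶ Z}
    (h : chartXY W ≫ f.left = chartXY W ≫ g.left) (h' : chartUV W ≫ f.left = chartUV W ≫ g.left) :
    f = g := by
  ext1
  exact pushout.hom_ext h h'

end WeierstrassScheme

/-! ### Field-valued points and their images -/

namespace WeierstrassScheme

variable {R : Type} [CommRing R] {W W' : WeierstrassCurve R}

instance : IsOpenImmersion (chartXY W) :=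
  inferInstanceAs (IsOpenImmersion
    (colimit.ι (span (overlapToXY W) (overlapToUV W)) WalkingSpan.left))

/-- Only the apex of the span maps to both charts, so the gluing identifies points of the charts
only along the overlap. -/
lemma exists_overlap_of_chart_eq {z : Spec (.of (XY W))} {z' : Spec (.of (UV W))}
    (h : chartXY W z = chartUV W z') : ∃ t, overlapToXY W t = z ∧ overlapToUV W t = z' := by
  obtain ⟨k, fi, fj, t, h1, h2⟩ := (Scheme.IsLocallyDirected.ι_eq_ι_iff
    (F := span (overlapToXY W) (overlapToUV W)) (i := WalkingSpan.left)
    (j := WalkingSpan.right)).mp h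
  match k, fi, fj, t with
  | none, fi, fj, t =>
    obtain rfl : fi = WalkingSpan.Hom.fst := Subsingleton.elim _ _
    obtain rfl : fj = WalkingSpan.Hom.snd := Subsingleton.elim _ _
    exact ⟨t, h1, h2⟩
  | some .left, fi, fj, t => exact nomatch fj
  | some .right, fi, fj, t => exact nomatch fi

variable {L : Type} [Field L] [Algebra R L]

/-- The function v vanishes at the identity but is a unit on the overlap, so the identity is not in
the `xy`-chart. -/
lemma ptUV_zero_ne_ptXY {x y : L} (h : EqXY W x y) (h0 : EqUV W (0 : L) 0) :
    ptXY x y h ≠ ptUV 0 0 h0 := by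
  intro e
  let s : Spec (.of L) := ⟨⊥, Ideal.isPrime_bot⟩
  have := congrArg (fun f => f s) e
  obtain ⟨t, -, h2⟩ := exists_overlap_of_chart_eq (W := W)
    (z := specMap (evalXY x y h : XY W →+* L) s)
    (z' := specMap (evalUV 0 0 h0 : UV W →+* L) s) this
  have hv : vc W ∈ (specMap (evalUV (0 : L) 0 h0 : UV W →+* L) s).asIdeal := by
    change evalUV (0 : L) 0 h0 (vc W) ∈ (⊥ : Ideal L)
    rw [evalUV_vc]; exact Ideal.zero_mem _
  rw [← h2] at hv
  change uvToXYy W (vc W) ∈ t.asIdeal at hv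
  rw [uvToXYy, evalUV_vc] at hv
  apply t.2.ne_top
  apply Ideal.eq_top_of_isUnit_mem _ hv
  exact IsUnit.of_mul_eq_one _
    ((mul_comm _ _).trans (IsLocalization.Away.mul_invSelf (S := XYy W) (yc W)))

lemma ptXY_injective {x y x' y' : L} {h : EqXY W x y} {h' : EqXY W x' y'}
    (e : ptXY x y h = ptXY x' y' h') : x = x' ∧ y = y' := by
  rw [ptXY, ptXY, cancel_mono] at e
  have e' := congrArg (fun f => f.hom) (Spec.map_injective e)
  have key : ∀ z, evalXY x y h z = evalXY x' y' h' z :=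
    fun z => congrArg (fun f : XY W →+* L => f z) e'
  have hx := key (xc W)
  have hy := key (yc W)
  rw [evalXY_xc, evalXY_xc] at hx
  rw [evalXY_yc, evalXY_yc] at hy
  exact ⟨hx, hy⟩

open WeierstrassCurve

lemma eqXY_of_nonsingular {x y : L} (h : (W⁄L).toAffine.Nonsingular x y) : EqXY W x y :=
  (Affine.equation_iff x y).mp h.1

lemma point_some {x y : L} (h : (W⁄L).toAffine.Nonsingular x y) :
    point (.some x y h) = ptXY (W := W) x y (eqXY_of_nonsingular h) := rfl

lemma eqUV_zero : EqUV W (0 : L) 0 := by unfold EqUV; ring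

lemma point_zero : point (0 : (W⁄L).toAffine.Point) = ptUV (W := W) 0 0 eqUV_zero := rfl

/-- The image of C[3] is described by equalities of morphisms; injectivity turns these back into
equalities of points. -/
lemma point_injective : Function.Injective (point (W := W) (L := L)) := by
  rintro (_ | ⟨x, y, h⟩) (_ | ⟨x', y', h'⟩) e
  · rfl
  · exact absurd (Eq.symm e) (ptUV_zero_ne_ptXY _ _)
  · exact absurd e (ptUV_zero_ne_ptXY _ _)
  · obtain ⟨rfl, rfl⟩ := ptXY_injective e
    rfl

variable {f : overBase W ⟶ overBase W'}

lemma point_some_comp {p q r : XY W} (hf : Represents (chartXY W ≫ f.left) p q r) {x y x' y' : L}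
    (h : (W⁄L).toAffine.Nonsingular x y) (h' : (W'⁄L).toAffine.Nonsingular x' y')
    (hr : evalXY x y (eqXY_of_nonsingular h) r ≠ 0)
    (hx : evalXY x y (eqXY_of_nonsingular h) r * x' = evalXY x y (eqXY_of_nonsingular h) p)
    (hy : evalXY x y (eqXY_of_nonsingular h) r * y' = evalXY x y (eqXY_of_nonsingular h) q) :
    point (.some x y h) ≫ f.left = point (.some x' y' h') := by
  rw [point_some, point_some]
  exact (Category.assoc _ _ _).trans (hf.xy _ _ _ _ hx hy (IsUnit.mk0 _ hr))

lemma point_some_comp_zero {p q r : XY W} (hf : Represents (chartXY W ≫ f.left) p q r) {x y : L}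
    (h : (W⁄L).toAffine.Nonsingular x y)
    (hp : evalXY x y (eqXY_of_nonsingular h) p = 0)
    (hq : evalXY x y (eqXY_of_nonsingular h) q ≠ 0)
    (hr : evalXY x y (eqXY_of_nonsingular h) r = 0) :
    point (.some x y h) ≫ f.left = point (0 : (W'⁄L).toAffine.Point) := by
  rw [point_some, point_zero]
  exact (Category.assoc _ _ _).trans (hf.uv _ _ _ _ (by rw [mul_zero, hp]) (by rw [mul_zero, hr])
    (IsUnit.mk0 _ hq))

lemma point_zero_comp {p q r : UV W} (hf : Represents (chartUV W ≫ f.left) p q r)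
    (hp : evalUV (0 : L) 0 eqUV_zero p = 0) (hq : evalUV (0 : L) 0 eqUV_zero q ≠ 0)
    (hr : evalUV (0 : L) 0 eqUV_zero r = 0) :
    point (0 : (W⁄L).toAffine.Point) ≫ f.left = point (0 : (W'⁄L).toAffine.Point) := by
  rw [point_zero, point_zero]
  exact (Category.assoc _ _ _).trans (hf.uv _ _ _ _ (by rw [mul_zero, hp]) (by rw [mul_zero, hr])
    (IsUnit.mk0 _ hq))

variable (W) in
/-- `v` is not a zero divisor on the `uv`-chart. -/
lemma mul_vc_eq_zero {z : UV W} (h : vc W * z = 0) : z = 0 := by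
  obtain ⟨p, rfl⟩ := AdjoinRoot.mk_surjective z
  rw [vc, ← map_mul, AdjoinRoot.mk_eq_zero] at h
  obtain ⟨s, hs⟩ := h
  -- Let s be the quotient of v·p by the cubic. Terms without v give -u³·s₀ = 0, hence s₀ = 0, so s
  -- is divisible by v and v cancels.
  have h0 := congrArg (fun f : R[X][Y] => f.coeff 0) hs
  have hc : (uvPolynomial W).coeff 0 = -X ^ 3 := by
    rw [coeff_zero_eq_eval_zero]
    simp [uvPolynomial]
  simp only [mul_coeff_zero, coeff_X_zero, zero_mul, hc, neg_mul] at h0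
  have hs0 : s.coeff 0 = 0 := by
    ext n
    have := congrArg (fun f : R[X] => f.coeff (n + 3)) h0
    simpa [coeff_X_pow_mul] using this.symm
  obtain ⟨t, rfl⟩ := X_dvd_iff.mpr hs0
  rw [AdjoinRoot.mk_eq_zero]
  refine ⟨t, ?_⟩
  ext1 n
  have := congrArg (fun f : R[X][Y] => f.coeff (n + 1)) hs
  rw [mul_left_comm] at this
  simpa only [coeff_X_mul] using this

end WeierstrassScheme

namespace FrobeniusSquare

open WeierstrassScheme WeierstrassCurve

/-! ### Parameters of the isogeny -/

section parameters

variable {R : Type} [CommRing R]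

/-- The parameter `κ` of a subgroup of order three, with `w = 1 + b κ`, `k = a / w`, and the number
`w'` which plays the role of `w` for the target of the isogeny. -/
structure Admissible (a b κ k w w' : R) : Prop where
  isUnit_b : IsUnit b
  isUnit_w : IsUnit w
  isUnit_w' : IsUnit w'
  isUnit_two : IsUnit (2 : R)
  isUnit_sub : IsUnit (w - 2)
  isUnit_sub' : IsUnit (w' - 2)
  a_eq : a = k * w
  k_sq : k ^ 2 = -(b * w * w')
  w_add : w + w' - w * w' = 4
  b_mul : b * κ = w - 1

lemma Admissible.isUnit_k {a b κ k w w' : R} (h : Admissible a b κ k w w') : IsUnit k := by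
  have := ((h.isUnit_b.mul h.isUnit_w).mul h.isUnit_w').neg
  rw [← h.k_sq] at this
  exact (isUnit_pow_iff two_ne_zero).mp this

lemma Admissible.isUnit_a {a b κ k w w' : R} (h : Admissible a b κ k w w') : IsUnit a := by
  rw [h.a_eq]; exact h.isUnit_k.mul h.isUnit_w

lemma Admissible.map {a b κ k w w' : R} (h : Admissible a b κ k w w') {S : Type} [CommRing S]
    (φ : R →+* S) : Admissible (φ a) (φ b) (φ κ) (φ k) (φ w) (φ w') where
  isUnit_b := h.isUnit_b.map φ
  isUnit_w := h.isUnit_w.map φ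
  isUnit_w' := h.isUnit_w'.map φ
  isUnit_two := by simpa only [map_ofNat] using h.isUnit_two.map φ
  isUnit_sub := by simpa only [map_sub, map_ofNat] using h.isUnit_sub.map φ
  isUnit_sub' := by simpa only [map_sub, map_ofNat] using h.isUnit_sub'.map φ
  a_eq := by simpa using congrArg φ h.a_eq
  k_sq := by simpa using congrArg φ h.k_sq
  w_add := by
    simpa only [map_add, map_sub, map_mul, map_ofNat] using congrArg φ h.w_add
  b_mul := by simpa using congrArg φ h.b_mul

/-- The target of the isogeny has the same kind of parameters. -/
lemma Admissible.dual {a b κ k w w' a' b' κ' : R} (h : Admissible a b κ k w w')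
    (ha : a' = -(b * w' * k)) (hb : b' = b ^ 3) (hκ : b ^ 3 * κ' = w' - 1) :
    Admissible a' b' κ' (-(b * k)) w' w where
  isUnit_b := hb ▸ h.isUnit_b.pow 3
  isUnit_w := h.isUnit_w'
  isUnit_w' := h.isUnit_w
  isUnit_two := h.isUnit_two
  isUnit_sub := h.isUnit_sub'
  isUnit_sub' := h.isUnit_sub
  a_eq := by rw [ha]; ring
  k_sq := by rw [hb]; linear_combination b ^ 2 * h.k_sq
  w_add := by linear_combination h.w_add
  b_mul := by rw [hb, hκ]

/-- The last factor of the discriminant is b(w - 2)³(w' - 2), which explains the unit conditions on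
w - 2 and w' - 2. -/
lemma Admissible.isElliptic {a b κ k w w' : R} (h : Admissible a b κ k w w') :
    (curve a b).IsElliptic := by
  refine ⟨?_⟩
  rw [curve_Δ, show a ^ 2 - 16 * b = b * (w - 2) ^ 3 * (w' - 2) by
    rw [h.a_eq]
    linear_combination w ^ 2 * h.k_sq + b * (2 * w ^ 2 - 4 * w + 8) * h.w_add]
  exact ((h.isUnit_a.pow 2).mul (h.isUnit_b.pow 4)).mul
    ((h.isUnit_b.mul (h.isUnit_sub.pow 3)).mul h.isUnit_sub')

/-- The coefficient `a'` of the target of the isogeny. -/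
lemma Admissible.targetA_eq {a b κ k w w' : R} (h : Admissible a b κ k w w') :
    targetA a b κ = -(b * w' * k) := by
  have key : (a ^ 2 * b ^ 4 - 4 * b ^ 5) * κ ^ 3 + 4 * b ^ 4 * κ ^ 2
    + (-6 * a ^ 2 * b ^ 2 + 20 * b ^ 3) * κ + a ^ 4 - 12 * a ^ 2 * b + 12 * b ^ 2 =
      a * -(b * w' * k) := by
    obtain ⟨hb, hw, hw', h2, hs, hs', ha, hk, hw4, hbκ⟩ := h
    subst ha
    obtain rfl : w = 1 + b * κ := by linear_combination -hbκ
    grind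
  rw [targetA, key, ← mul_assoc, Ring.inverse_mul_cancel _ h.isUnit_a, one_mul]

/-! ### Formulas for the isogeny -/

/-- The denominator of the isogeny. -/
def den (κ w x : R) : R := w + κ * x

/-- The numerator of the `x`-coordinate of the isogeny. -/
def numX (b w x : R) : R := x * (x ^ 2 + b * w * (4 - w) * x + b ^ 2 * w * (4 - w))

/-- The numerator of the `y`-coordinate of the isogeny. -/
def numY (b k w x y : R) : R :=
  y * (x + b * w) * (x ^ 2 + k * (w - 2) * y + k ^ 2 * (w - 1) ^ 2 * (x + b))

/-- The two-torsion point (-b, 0) is a double zero of x + b and maps to (-b³, 0). Where κ ≠ 0, the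
other preimages of that image are its translates by ±Q, which are the zeros of x + bw. -/
lemma numX_add {a b κ k w w' : R} (h : Admissible a b κ k w w') (x : R) :
    numX b w x + b ^ 3 * den κ w x ^ 2 = (x + b) * (x + b * w) ^ 2 := by
  simp only [numX, den]
  linear_combination (x ^ 2 * κ * b ^ 2 + x ^ 2 * b * w - x ^ 2 * b + 2 * x * b ^ 2 * w) * h.b_mul

/-- This is the equation of the target with the factor y(x + bw)² removed: `numX_add` supplies (x +
bw)², and the source equation y(y + a(x + b)) = x²(x + b) supplies y. -/
lemma quotient_equation_aux {b k w w' x y d n q : R} (κ : R) (hk : k ^ 2 = -(b * w * w'))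
    (hw : w + w' - w * w' = 4) (hb : b * κ = w - 1) (hd : d = w + κ * x)
    (hq : q = x ^ 2 + b * w * (4 - w) * x + b ^ 2 * w * (4 - w))
    (hn : n = x ^ 2 + k * (w - 2) * y + k ^ 2 * (w - 1) ^ 2 * (x + b))
    (e : y ^ 2 + k * w * x * y + k * w * b * y = x ^ 3 + b * x ^ 2) :
    y * n ^ 2 - b * w' * k * d * (x + b) * (x + b * w) * n = q ^ 2 * (y + k * w * (x + b)) := by
  subst hd hq hn
  grind

lemma quotient_equation {a b κ k w w' : R} (h : Admissible a b κ k w w') {x y : R}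
    (e : y ^ 2 + a * x * y + a * b * y = x ^ 3 + b * x ^ 2) :
    y * (x ^ 2 + k * (w - 2) * y + k ^ 2 * (w - 1) ^ 2 * (x + b)) ^ 2
      - b * w' * k * den κ w x * (x + b) * (x + b * w) *
        (x ^ 2 + k * (w - 2) * y + k ^ 2 * (w - 1) ^ 2 * (x + b)) =
      (x ^ 2 + b * w * (4 - w) * x + b ^ 2 * w * (4 - w)) ^ 2 * (y + a * (x + b)) := by
  obtain ⟨-, -, -, -, -, -, rfl, hk, hw4, hbκ⟩ := h
  exact quotient_equation_aux κ hk hw4 hbκ rfl rfl rfl e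

lemma num_equation {a b κ k w w' : R} (h : Admissible a b κ k w w') {x y : R}
    (e : y ^ 2 + a * x * y + a * b * y = x ^ 3 + b * x ^ 2) :
    numY b k w x y ^ 2 + -(b * w' * k) * numX b w x * den κ w x * numY b k w x y
      + -(b * w' * k) * b ^ 3 * numY b k w x y * den κ w x ^ 3 =
      numX b w x ^ 3 + b ^ 3 * numX b w x ^ 2 * den κ w x ^ 2 := by
  have h1 := numX_add h x
  have h2 := quotient_equation h e
  have e1 : numY b k w x y = y * (x + b * w) *
    (x ^ 2 + k * (w - 2) * y + k ^ 2 * (w - 1) ^ 2 * (x + b)) := rfl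
  have e2 : numX b w x = x * (x ^ 2 + b * w * (4 - w) * x + b ^ 2 * w * (4 - w)) := rfl
  generalize x ^ 2 + k * (w - 2) * y + k ^ 2 * (w - 1) ^ 2 * (x + b) = n at *
  generalize x ^ 2 + b * w * (4 - w) * x + b ^ 2 * w * (4 - w) = q at *
  generalize numX b w x = p at *
  generalize numY b k w x y = r at *
  generalize den κ w x = d at *
  subst e1
  linear_combination (-(b * w' * k * d * y * (x + b * w) * n) - p ^ 2) * h1
    + (x + b * w) ^ 2 * y * h2 + q ^ 2 * (x + b * w) ^ 2 * e -
    (x + b) * (x + b * w) ^ 2 * (p + x * q) * e2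

/-- The function 2y + ax + ab changes sign under negation, so its pullback is itself times a
function of x. This lets y be followed through a composite using polynomials in x alone. -/
lemma numY_add_numY {a b κ k w w' : R} (h : Admissible a b κ k w w') {x y : R}
    (e : y ^ 2 + a * x * y + a * b * y = x ^ 3 + b * x ^ 2) :
    2 * numY b k w x y + -(b * w' * k) * (numX b w x * den κ w x + b ^ 3 * den κ w x ^ 3) =
      (2 * y + a * x + a * b) * ((x + b * w) * (x ^ 2 + k ^ 2 * (x + b))) := by
  have h1 := numX_add h x
  rw [show numX b w x * den κ w x + b ^ 3 * den κ w x ^ 3 =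
    den κ w x * (numX b w x + b ^ 3 * den κ w x ^ 2) by ring, h1]
  have h2 : 2 * (y * (x ^ 2 + k * (w - 2) * y + k ^ 2 * (w - 1) ^ 2 * (x + b))) -
      b * w' * k * den κ w x * (x + b) * (x + b * w) =
      (2 * y + a * x + a * b) * (x ^ 2 + k ^ 2 * (x + b)) := by
    obtain ⟨hb, hw, hw', h2, hs, hs', ha, hk, hw4, hbκ⟩ := h
    subst ha
    simp only [den]
    linear_combination (2 * k * w - 4 * k) * e - (k * w * (x + b) ^ 2) * hk
      + (x ^ 3 * k + x ^ 2 * κ * k * b ^ 2 - x ^ 2 * k * b * w + 2 * x ^ 2 * k * b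
        + x * κ * k * b ^ 3 - x * k * b ^ 2 * w + x * k * b ^ 2) * hw4
      - (x ^ 3 * k * w' + x ^ 2 * k * b * w + 2 * x ^ 2 * k * b * w' - 4 * x ^ 2 * k * b
        + x * k * b ^ 2 * w + x * k * b ^ 2 * w' - 4 * x * k * b ^ 2) * hbκ
  simp only [numY]
  linear_combination (x + b * w) * h2

end parameters

end FrobeniusSquare

/-! ### Extending homogeneous coordinates across the chart at infinity -/

namespace WeierstrassScheme

variable {R : Type} [CommRing R] {W W' : WeierstrassCurve R}

-- Because v is not a zero divisor, identities on the `uv`-chart may be checked on the overlap.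
variable (W) in
lemma uvToXYy_injective : Function.Injective (uvToXYy W) := by
  rw [injective_iff_map_eq_zero]
  intro z hz
  rw [← overlapHom_algebraMap] at hz
  have h0 : algebraMap (UV W) (UVv W) z = 0 :=
    (overlapEquiv W).injective (hz.trans (map_zero (overlapEquiv W)).symm)
  rw [IsLocalization.map_eq_zero_iff (Submonoid.powers (vc W))] at h0
  obtain ⟨⟨_, n, rfl⟩, hn⟩ := h0
  induction n with
  | zero => simpa using hn
  | succ n ih =>
    apply ih
    apply mul_vc_eq_zero
    rw [← hn]
    simp only [pow_succ]
    ring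

/-- A proper ideal lies in a maximal one, so common zeros need only be excluded in residue fields.
-/
lemma span_pair_eq_top {T : Type} [CommRing T] [Algebra R T] {q r : T}
    (h : ∀ (K : Type) [Field K] [Algebra R K] (φ : T →ₐ[R] K), φ q = 0 → φ r ≠ 0) :
    Ideal.span {q, r} = ⊤ := by
  by_contra hne
  obtain ⟨M, hM, hle⟩ := Ideal.exists_le_maximal _ hne
  let _ : Field (T ⧸ M) := Ideal.Quotient.field M
  refine h (T ⧸ M) (Ideal.Quotient.mkₐ R M) ?_ ?_
  · exact Ideal.Quotient.eq_zero_iff_mem.mpr (hle (Ideal.subset_span (by simp)))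
  · exact Ideal.Quotient.eq_zero_iff_mem.mpr (hle (Ideal.subset_span (by simp)))

/-- Little remains to be checked at infinity: the homogeneous equation is inherited from the
overlap, and common zeros of q' and r' must be excluded only where v = 0. -/
lemma exists_hom_of_unit {p q r : XY W} {p' q' r' : UV W}
    (e : EqHom W' p q r) (h : Ideal.span {q, r} = ⊤) (c : XYy W) (hc : IsUnit c)
    (hp : uvToXYy W p' = c * algebraMap _ _ p) (hq : uvToXYy W q' = c * algebraMap _ _ q)
    (hr : uvToXYy W r' = c * algebraMap _ _ r) (h' : Ideal.span {q', vc W} = ⊤) :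
    ∃ f : overBase W ⟶ overBase W', Represents (chartXY W ≫ f.left) p q r ∧
      Represents (chartUV W ≫ f.left) p' q' r' := by
  refine exists_hom e h ?_ ?_ c hc hp hq hr
  · have e1 : EqHom W' (algebraMap (XY W) (XYy W) p) (algebraMap (XY W) (XYy W) q)
        (algebraMap (XY W) (XYy W) r) := e.map (IsScalarTower.toAlgHom R _ _)
    have e2 : EqHom W' (uvToXYy W p') (uvToXYy W q') (uvToXYy W r') := by
      rw [hp, hq, hr]
      unfold EqHom at e1 ⊢
      linear_combination c ^ 3 * e1
    apply uvToXYy_injective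
    simpa only [EqHom, map_add, map_mul, map_pow, AlgHom.commutes] using e2
  · apply span_pair_eq_top (R := R)
    intro K _ _ φ hφq hφr
    -- A common zero of q' and r' therefore lies on the overlap, where the coordinates are c times
    -- p, q, r and these do not vanish together.
    have hv : φ (vc W) ≠ 0 := by
      intro hv
      have h1 : (1 : UV W) ∈ Ideal.span {q', vc W} := h' ▸ Submodule.mem_top
      obtain ⟨s, t, hst⟩ := Ideal.mem_span_pair.mp h1
      have := congrArg φ hst
      simp [hφq, hv] at this
    let χ : UVv W →+* K := IsLocalization.Away.lift (vc W) (g := (φ : UV W →+* K))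
      (IsUnit.mk0 _ hv)
    have hχ : ∀ z, χ (overlapInv W (uvToXYy W z)) = φ z := fun z => by
      rw [← overlapHom_algebraMap]
      change χ ((overlapEquiv W).symm (overlapEquiv W (algebraMap (UV W) (UVv W) z))) = φ z
      rw [AlgEquiv.symm_apply_apply]
      exact IsLocalization.Away.lift_eq (vc W) (IsUnit.mk0 _ hv) z
    have hcu : χ (overlapInv W c) ≠ 0 := ((hc.map (overlapInv W)).map χ).ne_zero
    have h1 := hχ q'
    have h2 := hχ r'
    rw [hq, map_mul, map_mul, hφq, mul_eq_zero, or_iff_right hcu] at h1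
    rw [hr, map_mul, map_mul, hφr, mul_eq_zero, or_iff_right hcu] at h2
    have h3 : (1 : XY W) ∈ Ideal.span {q, r} := h ▸ Submodule.mem_top
    obtain ⟨s, t, hst⟩ := Ideal.mem_span_pair.mp h3
    have := congrArg (fun z => χ (overlapInv W (algebraMap (XY W) (XYy W) z))) hst
    simp [h1, h2] at this

end WeierstrassScheme

/-! ### The isogeny near the identity, and its construction -/

namespace FrobeniusSquare

open WeierstrassScheme WeierstrassCurve

section infinity

variable {T : Type} [CommRing T]

/-- The quotient `u ^ 3 / v` on the chart at infinity. -/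
def cubeQuot (a b u v : T) : T := 1 + a * u + a * b * v - b * u ^ 2

/-- The first homogeneous coordinate of the isogeny on the chart at infinity. -/
def infX (a b κ w u v : T) : T :=
  κ * u * cubeQuot a b u v + (w + b * w * (4 - w) * κ) * u ^ 3 +
    (b * w * (4 - w) * w + b ^ 2 * w * (4 - w) * κ) * u ^ 2 * v + b ^ 2 * w * (4 - w) * w * u * v ^ 2

/-- The second homogeneous coordinate of the isogeny on the chart at infinity. -/
def infY (a b k w u v : T) : T :=
  cubeQuot a b u v + b * w * u ^ 2 +
    (u + b * w * v) * (k * (w - 2) + k ^ 2 * (w - 1) ^ 2 * (u + b * v))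

/-- The third homogeneous coordinate of the isogeny on the chart at infinity. -/
def infZ (κ w u v : T) : T := (κ * u + w * v) ^ 3

variable {a b κ k w x y t : T}

/-- This is u³/v, which the curve equation makes a polynomial in u and v. It removes v from the
denominators of the terms of highest degree in x. -/
lemma cube_eq (e : y ^ 2 + a * x * y + a * b * y = x ^ 3 + b * x ^ 2)
    (ht : y * t = 1) :
    x ^ 3 * t ^ 2 = cubeQuot a b (x * t) t := by
  simp only [cubeQuot]
  linear_combination -t ^ 2 * e + (y * t + 1 + a * x * t + a * b * t) * ht

lemma infX_eq (e : y ^ 2 + a * x * y + a * b * y = x ^ 3 + b * x ^ 2)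
    (ht : y * t = 1) :
    infX a b κ w (x * t) t = t ^ 3 * (numX b w x * den κ w x) := by
  simp only [infX, numX, den, ← cube_eq e ht]
  ring

lemma infY_eq (e : y ^ 2 + a * x * y + a * b * y = x ^ 3 + b * x ^ 2)
    (ht : y * t = 1) :
    infY a b k w (x * t) t = t ^ 3 * numY b k w x y := by
  simp only [infY, numY, ← cube_eq e ht]
  linear_combination -(t ^ 2 * (x + b * w) * (x ^ 2 + k ^ 2 * (w - 1) ^ 2 * (x + b)) +
    (y * t + 1) * t * (x + b * w) * k * (w - 2)) * ht

lemma infZ_eq : infZ κ w (x * t) t = t ^ 3 * den κ w x ^ 3 := by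
  simp only [infZ, den]
  ring

end infinity

section maps

variable {S T : Type} [CommRing S] [CommRing T] (φ : S →+* T)

lemma map_den (κ w x : S) : φ (den κ w x) = den (φ κ) (φ w) (φ x) := by
  simp only [den, map_add, map_mul]

lemma map_numX (b w x : S) : φ (numX b w x) = numX (φ b) (φ w) (φ x) := by
  simp only [numX, map_add, map_sub, map_mul, map_pow, map_ofNat]

lemma map_numY (b k w x y : S) : φ (numY b k w x y) = numY (φ b) (φ k) (φ w) (φ x) (φ y) := by
  simp only [numY, map_add, map_sub, map_mul, map_pow, map_ofNat, map_one]

lemma map_infX (a b κ w u v : S) :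
    φ (infX a b κ w u v) = infX (φ a) (φ b) (φ κ) (φ w) (φ u) (φ v) := by
  simp only [infX, cubeQuot, map_add, map_sub, map_mul, map_pow, map_ofNat, map_one]

lemma map_infY (a b k w u v : S) :
    φ (infY a b k w u v) = infY (φ a) (φ b) (φ k) (φ w) (φ u) (φ v) := by
  simp only [infY, cubeQuot, map_add, map_sub, map_mul, map_pow, map_ofNat, map_one]

lemma map_infZ (κ w u v : S) : φ (infZ κ w u v) = infZ (φ κ) (φ w) (φ u) (φ v) := by
  simp only [infZ, map_add, map_mul, map_pow]

end maps

/-- The numerator and the denominator of the isogeny have no common zero. -/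
lemma numY_ne_zero {K : Type} [Field K] {a b κ k w w' x y : K} (h : Admissible a b κ k w w')
    (e : y ^ 2 + a * x * y + a * b * y = x ^ 3 + b * x ^ 2) (hd : den κ w x = 0) :
    numY b k w x y ≠ 0 := by
  obtain ⟨hb, hw, hw', h2, hs, hs', ha, hk, hw4, hbκ⟩ := h
  have hw := hw.ne_zero
  have hs := hs.ne_zero
  have hκ : κ ≠ 0 := by
    rintro rfl
    simp only [den, zero_mul, add_zero] at hd
    exact hw hd
  simp only [den] at hd
  have hk2 : k ^ 2 * κ = w * (4 - w) := by
    linear_combination κ * hk - w * w' * hbκ + w * hw4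
  -- Powers of κ clear the denominators in x = -w/κ and x + b = -1/κ. Each factor of `numY`, if
  -- zero, then makes a product of powers of w and w - 2 vanish.
  have hxb : κ * (x + b) = -1 := by linear_combination hd + hbκ
  intro h0
  rw [numY, mul_eq_zero, mul_eq_zero] at h0
  rcases h0 with (rfl | h0) | h0
  · have : w ^ 2 = 0 := by
      linear_combination (w - κ * x) * hd + κ ^ 3 * e + κ ^ 2 * x ^ 2 * hxb
    exact hw (pow_eq_zero_iff two_ne_zero |>.mp this)
  · have : w * (w - 2) = 0 := by linear_combination κ * h0 - hd - w * hbκ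
    exact mul_ne_zero hw hs this
  · have hx2 : κ ^ 2 * x ^ 2 = w ^ 2 := by linear_combination (κ * x - w) * hd
    have h4 : κ ^ 2 * k * y = -(w * (w ^ 2 - 4 * w + 2)) := by
      apply mul_left_cancel₀ hs
      linear_combination κ ^ 2 * h0 - hx2 - k ^ 2 * κ * (w - 1) ^ 2 * hxb + (w - 1) ^ 2 * hk2
    have : w ^ 2 * (w - 2) ^ 2 = 0 := by
      subst ha
      linear_combination κ ^ 4 * k ^ 2 * e - (κ ^ 2 * k * y - w * (w ^ 2 - 4 * w + 2)) * h4
        - w * (κ ^ 2 * k * y * (k ^ 2 * κ) * hxb - κ ^ 2 * k * y * hk2 - w * (4 - w) * h4)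
        + (k ^ 2 * κ * (κ ^ 2 * x ^ 2) * hxb - k ^ 2 * κ * hx2 - w ^ 2 * hk2)
    exact mul_ne_zero (pow_ne_zero 2 hw) (pow_ne_zero 2 hs) this

section construction

variable {R : Type} [CommRing R]

/-- The morphism `ψ` is given on geometric points by the formulas for the isogeny. -/
def IsGivenByFormulas (b κ k w : R) {E E' : WeierstrassCurve R}
    (ψ : overBase E ⟶ overBase E') : Prop :=
  ∀ (L : Type) [Field L] [Algebra R L],
    point (0 : (E⁄L).toAffine.Point) ≫ ψ.left = point (0 : (E'⁄L).toAffine.Point) ∧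
    ∀ (x y : L) (h : (E⁄L).toAffine.Nonsingular x y),
      (den (algebraMap R L κ) (algebraMap R L w) x = 0 →
        point (.some x y h) ≫ ψ.left = point (0 : (E'⁄L).toAffine.Point)) ∧
      ∀ (x' y' : L) (h' : (E'⁄L).toAffine.Nonsingular x' y'),
        den (algebraMap R L κ) (algebraMap R L w) x ≠ 0 →
        den (algebraMap R L κ) (algebraMap R L w) x ^ 2 * x' =
          numX (algebraMap R L b) (algebraMap R L w) x →
        den (algebraMap R L κ) (algebraMap R L w) x ^ 3 * y' =
          numY (algebraMap R L b) (algebraMap R L k) (algebraMap R L w) x y →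
        point (.some x y h) ≫ ψ.left = point (.some x' y' h')

lemma eqXY_curve {a b : R} {T : Type} [CommRing T] [Algebra R T] {x y : T} :
    EqXY (curve a b) x y ↔ y ^ 2 + algebraMap R T a * x * y + algebraMap R T a * algebraMap R T b * y
      = x ^ 3 + algebraMap R T b * x ^ 2 := by
  simp only [EqXY, curve, map_mul, map_zero, zero_mul, add_zero]

lemma eqHom_curve {a b : R} {T : Type} [CommRing T] [Algebra R T] {p q r : T} :
    EqHom (curve a b) p q r ↔ q ^ 2 * r + algebraMap R T a * p * q * r +
      algebraMap R T a * algebraMap R T b * q * r ^ 2 = p ^ 3 + algebraMap R T b * p ^ 2 * r := by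
  simp only [EqHom, curve, map_mul, map_zero, zero_mul, add_zero]

/-- The existence of the isogeny. -/
lemma exists_isogeny {a b κ k w w' a' b' : R} (h : Admissible a b κ k w w')
    (ha' : a' = -(b * w' * k)) (hb' : b' = b ^ 3) :
    ∃ ψ : overBase (curve a b) ⟶ overBase (curve a' b'), IsGivenByFormulas b κ k w ψ := by
  let E := curve a b
  let ι : R →+* XY E := algebraMap R (XY E)
  let j : R →+* UV E := algebraMap R (UV E)
  let l : R →+* XYy E := algebraMap R (XYy E)
  let t : XYy E := IsLocalization.Away.invSelf (yc E)
  let τ : XY E →+* XYy E := algebraMap (XY E) (XYy E)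
  have hι : ∀ r, τ (ι r) = l r := fun r => (IsScalarTower.algebraMap_apply R (XY E) (XYy E) r).symm
  have hj : ∀ r, (uvToXYy E : UV E →+* XYy E) (j r) = l r := (uvToXYy E).commutes
  have hu : (uvToXYy E : UV E →+* XYy E) (uc E) = τ (xc E) * t := by
    change uvToXYy E (uc E) = _
    rw [uvToXYy, evalUV_uc]
  have hv : (uvToXYy E : UV E →+* XYy E) (vc E) = t := by
    change uvToXYy E (vc E) = _
    rw [uvToXYy, evalUV_vc]
  have hcurve := eqXY_curve.mp (equation_xy E)
  have hcurve' := eqXY_curve.mp (EqXY.map (W := E) (IsScalarTower.toAlgHom R (XY E) (XYy E))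
    (equation_xy E))
  have ht : τ (yc E) * t = 1 := IsLocalization.Away.mul_invSelf (S := XYy E) (yc E)
  have eHom : EqHom (curve a' b') (numX (ι b) (ι w) (xc E) * den (ι κ) (ι w) (xc E))
      (numY (ι b) (ι k) (ι w) (xc E) (yc E)) (den (ι κ) (ι w) (xc E) ^ 3) := by
    rw [eqHom_curve, ha', hb']
    have := num_equation (h.map ι) hcurve
    simp only [map_neg, map_mul, map_pow]
    linear_combination den (ι κ) (ι w) (xc E) ^ 3 * this
  obtain ⟨ψ, hψ, hψ'⟩ := exists_hom_of_unit (W := E) (W' := curve a' b')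
    (p' := infX (j a) (j b) (j κ) (j w) (uc E) (vc E))
    (q' := infY (j a) (j b) (j k) (j w) (uc E) (vc E))
    (r' := infZ (j κ) (j w) (uc E) (vc E)) eHom (by
      apply span_pair_eq_top (R := R)
      intro K _ _ φ h1 h2
      have hφ : ∀ r, (φ : XY E →+* K) (ι r) = algebraMap R K r := φ.commutes
      rw [map_pow, pow_eq_zero_iff three_ne_zero] at h2
      have e := (eqXY_curve.mp (EqXY.map (W := E) φ (equation_xy E)))
      refine numY_ne_zero (h.map (algebraMap R K)) e ?_ ?_
      · rw [← h2, ← hφ, ← hφ]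
        exact (map_den (φ : XY E →+* K) _ _ _).symm
      · rw [← h1, ← hφ, ← hφ, ← hφ]
        exact (map_numY (φ : XY E →+* K) _ _ _ _ _).symm)
    -- The unit y⁻³ relates the coordinates on the two charts.
    (t ^ 3) ((IsUnit.of_mul_eq_one _ ((mul_comm _ _).trans ht)).pow 3)
    (by
      change (uvToXYy E : UV E →+* XYy E) _ = t ^ 3 * τ _
      rw [map_infX, map_mul, map_numX, map_den, hj, hj, hj, hj, hι, hι, hι, hu, hv]
      exact infX_eq hcurve' ht)
    (by
      change (uvToXYy E : UV E →+* XYy E) _ = t ^ 3 * τ _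
      rw [map_infY, map_numY, hj, hj, hj, hj, hι, hι, hι, hu, hv]
      exact infY_eq hcurve' ht)
    (by
      change (uvToXYy E : UV E →+* XYy E) _ = t ^ 3 * τ _
      rw [map_infZ, map_pow, map_den, hj, hj, hι, hι, hu, hv]
      exact infZ_eq)
    (by
      apply span_pair_eq_top (R := R)
      intro K _ _ φ h1 h2
      -- At v = 0 the equation leaves u³ = 0, and at the identity the second coordinate equals 1.
      have e := EqUV.map (W := E) φ (equation_uv E)
      rw [EqUV, h2] at e
      have hu0 : φ (uc E) = 0 := by
        apply (pow_eq_zero_iff three_ne_zero).mp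
        linear_combination -e
      change (φ : UV E →+* K) _ = 0 at h1
      change (φ : UV E →+* K) _ = 0 at h2
      change (φ : UV E →+* K) _ = 0 at hu0
      rw [map_infY, hu0, h2] at h1
      simp [infY, cubeQuot] at h1)
  refine ⟨ψ, fun L _ _ => ⟨?_, fun x y hxy => ?_⟩⟩
  · have hφ : ∀ r, (evalUV (W := E) (0 : L) 0 eqUV_zero : UV E →+* L) (j r) = algebraMap R L r :=
      (evalUV (W := E) (0 : L) 0 eqUV_zero).commutes
    have hu0 : (evalUV (W := E) (0 : L) 0 eqUV_zero : UV E →+* L) (uc E) = 0 :=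
      evalUV_uc 0 0 eqUV_zero
    have hv0 : (evalUV (W := E) (0 : L) 0 eqUV_zero : UV E →+* L) (vc E) = 0 :=
      evalUV_vc 0 0 eqUV_zero
    refine point_zero_comp hψ' ?_ ?_ ?_
    · change (evalUV (W := E) (0 : L) 0 eqUV_zero : UV E →+* L) _ = 0
      rw [map_infX, hu0, hv0]
      simp [infX]
    · change (evalUV (W := E) (0 : L) 0 eqUV_zero : UV E →+* L) _ ≠ 0
      rw [map_infY, hu0, hv0]
      simp [infY, cubeQuot]
    · change (evalUV (W := E) (0 : L) 0 eqUV_zero : UV E →+* L) _ = 0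
      rw [map_infZ, hu0, hv0]
      simp [infZ]
  · have e := eqXY_of_nonsingular (W := E) hxy
    let φ : XY E →+* L := evalXY (W := E) x y e
    have hφ : ∀ r, φ (ι r) = algebraMap R L r := (evalXY (W := E) x y e).commutes
    have hx : φ (xc E) = x := evalXY_xc x y e
    have hy : φ (yc E) = y := evalXY_yc x y e
    have h1 : φ (den (ι κ) (ι w) (xc E)) = den (algebraMap R L κ) (algebraMap R L w) x := by
      rw [map_den, hφ, hφ, hx]
    have h2 : φ (numX (ι b) (ι w) (xc E)) = numX (algebraMap R L b) (algebraMap R L w) x := by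
      rw [map_numX, hφ, hφ, hx]
    have h3 : φ (numY (ι b) (ι k) (ι w) (xc E) (yc E)) =
        numY (algebraMap R L b) (algebraMap R L k) (algebraMap R L w) x y := by
      rw [map_numY, hφ, hφ, hφ, hx, hy]
    constructor
    · intro hd
      refine point_some_comp_zero hψ hxy ?_ ?_ ?_
      · change φ _ = 0
        rw [map_mul, h1, hd, mul_zero]
      · change φ _ ≠ 0
        rw [h3]
        exact numY_ne_zero (h.map (algebraMap R L)) (eqXY_curve.mp e) hd
      · change φ _ = 0
        rw [map_pow, h1, hd, zero_pow three_ne_zero]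
    · intro x' y' h' hd hx' hy'
      refine point_some_comp hψ hxy h' ?_ ?_ ?_
      · change φ _ ≠ 0
        rw [map_pow, h1]
        exact pow_ne_zero 3 hd
      · change φ _ * x' = φ _
        rw [map_pow, map_mul, h1, h2, ← hx']
        ring
      · change φ _ * y' = φ _
        rw [map_pow, h1, h3, ← hy']

end construction

end FrobeniusSquare

/-! ### Isomorphisms given by rescaling coordinates -/

namespace WeierstrassScheme

variable {R : Type} [CommRing R] {W W' : WeierstrassCurve R}

/-- The curve `W'` arises from `W` by the change of coordinates `(x, y) ↦ (s² x, s³ y)`. -/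
structure IsScaledBy (s : R) (W W' : WeierstrassCurve R) : Prop where
  a₁ : W'.a₁ = s * W.a₁
  a₂ : W'.a₂ = s ^ 2 * W.a₂
  a₃ : W'.a₃ = s ^ 3 * W.a₃
  a₄ : W'.a₄ = s ^ 4 * W.a₄
  a₆ : W'.a₆ = s ^ 6 * W.a₆

lemma IsScaledBy.symm {s t : R} (h : IsScaledBy s W W') (hst : s * t = 1) :
    IsScaledBy t W' W where
  a₁ := by rw [h.a₁, ← mul_assoc, mul_comm t, hst, one_mul]
  a₂ := by rw [h.a₂, ← mul_assoc, ← mul_pow, mul_comm t, hst, one_pow, one_mul]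
  a₃ := by rw [h.a₃, ← mul_assoc, ← mul_pow, mul_comm t, hst, one_pow, one_mul]
  a₄ := by rw [h.a₄, ← mul_assoc, ← mul_pow, mul_comm t, hst, one_pow, one_mul]
  a₆ := by rw [h.a₆, ← mul_assoc, ← mul_pow, mul_comm t, hst, one_pow, one_mul]

variable {T : Type} [CommRing T] [Algebra R T]

lemma EqXY.scale {s : R} (h : IsScaledBy s W W') {x y : T} (e : EqXY W x y) :
    EqXY W' (algebraMap R T s ^ 2 * x) (algebraMap R T s ^ 3 * y) := by
  unfold EqXY at e ⊢
  simp only [h.a₁, h.a₂, h.a₃, h.a₄, h.a₆, map_mul, map_pow]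
  linear_combination algebraMap R T s ^ 6 * e

lemma EqUV.scale {s t : R} (h : IsScaledBy s W W') (hst : s * t = 1) {u v : T} (e : EqUV W u v) :
    EqUV W' (algebraMap R T t * u) (algebraMap R T t ^ 3 * v) := by
  have h' := h.symm hst
  unfold EqUV at e ⊢
  rw [h'.a₁, h'.a₂, h'.a₃, h'.a₄, h'.a₆] at e
  simp only [map_mul, map_pow] at e
  linear_combination algebraMap R T t ^ 3 * e

lemma exists_scaling_hom {s t : R} (h : IsScaledBy s W W') (hst : s * t = 1) :
    ∃ f : overBase W ⟶ overBase W',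
      chartXY W ≫ f.left = ptXY _ _ (EqXY.scale h (equation_xy W)) ∧
      chartUV W ≫ f.left = ptUV _ _ (EqUV.scale h hst (equation_uv W)) := by
  have hcomp : overlapToXY W ≫ ptXY _ _ (EqXY.scale h (equation_xy W)) =
      overlapToUV W ≫ ptUV _ _ (EqUV.scale h hst (equation_uv W)) := by
    have h1 := specMap_ptXY (IsScalarTower.toAlgHom R (XY W) (XYy W))
      (EqXY.scale h (equation_xy W))
    have h2 := specMap_ptUV (uvToXYy W) (EqUV.scale h hst (equation_uv W))
    refine h1.trans (Eq.trans ?_ h2.symm)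
    have hinv := IsLocalization.Away.mul_invSelf (S := XYy W) (yc W)
    have hst' := congrArg (algebraMap R (XYy W)) hst
    rw [map_mul, map_one] at hst'
    have hu : uvToXYy W (uc W) = _ := evalUV_uc _ _ _
    have hv : uvToXYy W (vc W) = _ := evalUV_vc _ _ _
    apply ptXY_eq_ptUV
    · rw [map_mul, map_mul, map_pow, map_pow, AlgHom.commutes, AlgHom.commutes, hv,
        IsScalarTower.coe_toAlgHom']
      calc _ = (algebraMap R (XYy W) s * algebraMap R (XYy W) t) ^ 3 *
          (algebraMap (XY W) (XYy W) (yc W) * IsLocalization.Away.invSelf (yc W)) := by ring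
        _ = 1 := by rw [hst', hinv, one_pow, one_mul]
    · rw [map_mul, map_mul, map_mul, map_pow, map_pow, AlgHom.commutes, AlgHom.commutes, hv, hu,
        IsScalarTower.coe_toAlgHom']
      calc _ = 1 ^ 2 * (algebraMap R (XYy W) t * (algebraMap (XY W) (XYy W) (xc W) *
          IsLocalization.Away.invSelf (yc W))) := by rw [one_pow, one_mul]
        _ = _ := by rw [← hst']; ring
  have hb : pushout.desc _ _ hcomp ≫ toBase W' = toBase W := by
    apply pushout.hom_ext
    · rw [pushout.inl_desc_assoc, ptXY_toBase]; exact chartXY_toBase.symm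
    · rw [pushout.inr_desc_assoc, ptUV_toBase]; exact chartUV_toBase.symm
  exact ⟨Over.homMk (pushout.desc _ _ hcomp) hb, pushout.inl_desc _ _ _, pushout.inr_desc _ _ _⟩

lemma scaling_comp {s t : R} (h : IsScaledBy s W W') (hst : s * t = 1)
    (h' : IsScaledBy t W' W) (hts : t * s = 1)
    {f : overBase W ⟶ overBase W'} {g : overBase W' ⟶ overBase W}
    (hf : chartXY W ≫ f.left = ptXY _ _ (EqXY.scale h (equation_xy W)))
    (hf' : chartUV W ≫ f.left = ptUV _ _ (EqUV.scale h hst (equation_uv W)))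
    (hg : chartXY W' ≫ g.left = ptXY _ _ (EqXY.scale h' (equation_xy W')))
    (hg' : chartUV W' ≫ g.left = ptUV _ _ (EqUV.scale h' hts (equation_uv W'))) :
    f ≫ g = 𝟙 _ := by
  apply hom_ext
  · have : chartXY W ≫ (f ≫ g).left = (chartXY W ≫ f.left) ≫ g.left :=
      (Category.assoc _ _ _).symm
    rw [this, hf, ptXY]
    refine (Category.assoc _ _ _).trans ?_
    refine (congrArg (fun z => specMap _ ≫ z) hg).trans
      ((specMap_ptXY _ _).trans ?_)
    refine Eq.trans ?_ (chartXY_eq_ptXY.symm.trans (Category.comp_id _).symm)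
    have hst' := congrArg (algebraMap R (XY W)) hst
    rw [map_mul, map_one] at hst'
    apply ptXY_congr
    · rw [map_mul, map_pow, AlgHom.commutes, evalXY_xc]
      linear_combination (algebraMap R (XY W) s * algebraMap R (XY W) t + 1) * xc W * hst'
    · rw [map_mul, map_pow, AlgHom.commutes, evalXY_yc, ← mul_assoc, ← mul_pow,
        mul_comm (algebraMap R (XY W) t), hst', one_pow, one_mul]
  · have : chartUV W ≫ (f ≫ g).left = (chartUV W ≫ f.left) ≫ g.left :=
      (Category.assoc _ _ _).symm
    rw [this, hf', ptUV]
    refine (Category.assoc _ _ _).trans ?_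
    refine (congrArg (fun z => specMap _ ≫ z) hg').trans
      ((specMap_ptUV _ _).trans ?_)
    refine Eq.trans ?_ (chartUV_eq_ptUV.symm.trans (Category.comp_id _).symm)
    have hst' := congrArg (algebraMap R (UV W)) hst
    rw [map_mul, map_one] at hst'
    apply ptUV_congr
    · rw [map_mul, AlgHom.commutes, evalUV_uc, ← mul_assoc, hst', one_mul]
    · rw [map_mul, map_pow, AlgHom.commutes, evalUV_vc, ← mul_assoc, ← mul_pow, hst', one_pow,
        one_mul]

end WeierstrassScheme

namespace FrobeniusSquare

open WeierstrassScheme WeierstrassCurve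

lemma exists_scaling {R : Type} [CommRing R] {W W' : WeierstrassCurve R} [W'.IsElliptic] {s t : R}
    (h : IsScaledBy s W W') (hst : s * t = 1) :
    ∃ ι : overBase W ≅ overBase W', IsScaling t ι.hom := by
  have hts : t * s = 1 := by rw [mul_comm, hst]
  obtain ⟨f, hf, hf'⟩ := exists_scaling_hom h hst
  obtain ⟨g, hg, hg'⟩ := exists_scaling_hom (h.symm hst) hts
  refine ⟨⟨f, g, scaling_comp h hst (h.symm hst) hts hf hf' hg hg',
    scaling_comp (h.symm hst) hts h hst hg hg' hf hf'⟩, ?_⟩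
  intro L _ _ _ _
  refine ⟨?_, ?_⟩
  · rw [point_zero, point_zero, ptUV]
    refine (Category.assoc _ _ _).trans ?_
    refine (congrArg (fun z => specMap _ ≫ z) hf').trans
      ((specMap_ptUV _ _).trans ?_)
    apply ptUV_congr
    · rw [map_mul, evalUV_uc, mul_zero]
    · rw [map_mul, evalUV_vc, mul_zero]
  · intro x y hxy
    have hst' := congrArg (algebraMap R L) hst
    rw [map_mul, map_one] at hst'
    have hs : (algebraMap R L t)⁻¹ = algebraMap R L s := 
      (eq_inv_of_mul_eq_one_left hst').symm
    have e := EqXY.scale h (eqXY_of_nonsingular hxy)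
    rw [← hs] at e
    have : (W'⁄L).toAffine.IsElliptic :=
      inferInstanceAs (W'.map (algebraMap R L)).IsElliptic
    refine ⟨(Affine.equation_iff_nonsingular (W := (W'⁄L).toAffine)).mp
      ((Affine.equation_iff _ _).mpr e), ?_⟩
    rw [point_some, point_some, ptXY]
    refine (Category.assoc _ _ _).trans ?_
    refine (congrArg (fun z => specMap _ ≫ z) hf).trans
      ((specMap_ptXY _ _).trans ?_)
    apply ptXY_congr
    · rw [map_mul, map_pow, evalXY_xc, AlgHom.commutes, hs]
    · rw [map_mul, map_pow, evalXY_yc, AlgHom.commutes, hs]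

end FrobeniusSquare

namespace FrobeniusSquare

open WeierstrassScheme WeierstrassCurve WeierstrassCurve.Affine

/-! ### Points of order three and multiplication by three -/

section tripling

variable {F : Type} [Field F] {a b : F} {V : WeierstrassCurve F}

/-- The square of `2 y + a x + a b` as a polynomial in `x`. -/
def twoDivPoly (a b x : F) : F :=
  4 * x ^ 3 + (a ^ 2 + 4 * b) * x ^ 2 + 2 * a ^ 2 * b * x + a ^ 2 * b ^ 2

/-- Half of the derivative of `twoDivPoly`. -/
def halfDeriv (a b x : F) : F := 6 * x ^ 2 + (a ^ 2 + 4 * b) * x + a ^ 2 * b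

/-- The third division polynomial. -/
def threeDivPoly (a b x : F) : F :=
  3 * x ^ 4 + (a ^ 2 + 4 * b) * x ^ 3 + 3 * (a ^ 2 * b) * x ^ 2 + 3 * (a ^ 2 * b ^ 2) * x + a ^ 2 * b ^ 3

/-- The quotient of the fourth and the second division polynomials. -/
def fourDivPoly (a b x : F) : F :=
  2 * x ^ 6 + (a ^ 2 + 4 * b) * x ^ 5 + 5 * (a ^ 2 * b) * x ^ 4 + 10 * (a ^ 2 * b ^ 2) * x ^ 3 +
    10 * (a ^ 2 * b ^ 3) * x ^ 2 + 4 * a ^ 2 * b ^ 4 * x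

/-- With f = `twoDivPoly` this is the classical 4ψ₃ = f·(f''/2) - (f'/2)². It yields x(2P) and the
coprimality of f and ψ₃ at points of order two. -/
lemma halfDeriv_sq (a b x : F) : halfDeriv a b x ^ 2 =
    twoDivPoly a b x * (12 * x + a ^ 2 + 4 * b) - 4 * threeDivPoly a b x := by
  simp only [halfDeriv, twoDivPoly, threeDivPoly]
  ring

/-- The squared expression is (2m + a)ψ₃·(2y + ax + ab), where m is the slope of the line through 2P
and P; its square is what the addition formula for x(3P) requires. -/
lemma division_identity (a b x : F) :
    (2 * twoDivPoly a b x ^ 2 - halfDeriv a b x * threeDivPoly a b x) ^ 2 =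
      threeDivPoly a b x ^ 2 * twoDivPoly a b x * (a ^ 2 + 4 * b + 12 * x)
        - 4 * threeDivPoly a b x ^ 3 - 4 * twoDivPoly a b x ^ 2 * fourDivPoly a b x := by
  simp only [halfDeriv, twoDivPoly, threeDivPoly, fourDivPoly]
  ring

lemma curve_equation_iff (hV : V = curve a b) {x y : F} : V.toAffine.Equation x y ↔
    y ^ 2 + a * x * y + a * b * y = x ^ 3 + b * x ^ 2 := by
  subst hV
  rw [equation_iff]
  simp only [curve, zero_mul, add_zero]

lemma curve_negY (hV : V = curve a b) (x y : F) : V.toAffine.negY x y = -y - a * x - a * b := by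
  subst hV
  rfl

lemma sq_eq_twoDivPoly {x y : F} (e : y ^ 2 + a * x * y + a * b * y = x ^ 3 + b * x ^ 2) :
    (2 * y + a * x + a * b) ^ 2 = twoDivPoly a b x := by
  simp only [twoDivPoly]
  linear_combination 4 * e

lemma some_congr {x y x' y' : F} {h : V.toAffine.Nonsingular x y}
    {h' : V.toAffine.Nonsingular x' y'} (hx : x = x') (hy : y = y') :
    Point.some x y h = Point.some x' y' h' := by
  subst hx hy
  rfl

/-- At a point of order two, the third division polynomial does not vanish. -/
lemma threeDivPoly_ne_zero (hV : V = curve a b) {x y : F} (h : V.toAffine.Nonsingular x y)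
    (h2 : (2 : F) ≠ 0) (hg : 2 * y + a * x + a * b = 0) : threeDivPoly a b x ≠ 0 := by
  intro h0
  have e := (curve_equation_iff hV).mp h.1
  have hs := halfDeriv_sq a b x
  rw [← sq_eq_twoDivPoly e, hg, h0] at hs
  -- A common zero of f and ψ₃ is a double zero of f, and then both partial derivatives of the curve
  -- equation vanish.
  have hd : halfDeriv a b x = 0 := by
    apply (pow_eq_zero_iff two_ne_zero).mp
    rw [hs]; ring
  subst hV
  rw [nonsingular_iff'] at h
  simp only [curve] at h
  rcases h.2 with h3 | h3
  · apply h3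
    apply mul_left_cancel₀ h2
    simp only [halfDeriv] at hd
    linear_combination a * hg - hd
  · exact h3 (by linear_combination hg)

lemma add_self_x {x x' l g : F} (h2 : (2 : F) ≠ 0) (hg : g ^ 2 = twoDivPoly a b x)
    (hl : (2 * l + a) * g = halfDeriv a b x)
    (hx' : 4 * x' = (2 * l + a) ^ 2 - (a ^ 2 + 4 * b) - 8 * x) :
    (x' - x) * g ^ 2 = -threeDivPoly a b x := by
  have h4 : (4 : F) ≠ 0 := by
    have := mul_ne_zero h2 h2
    norm_num at this
    exact this
  apply mul_left_cancel₀ h4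
  linear_combination g ^ 2 * hx' + ((2 * l + a) * g + halfDeriv a b x) * hl + halfDeriv_sq a b x
    - (12 * x + a ^ 2 + 4 * b) * hg

variable [DecidableEq F]

lemma add_self_eq (hV : V = curve a b) {x y : F} (h : V.toAffine.Nonsingular x y)
    (hg : 2 * y + a * x + a * b ≠ 0) : ∃ (l x' y' : F) (h' : V.toAffine.Nonsingular x' y'),
      Point.some x y h + Point.some x y h = Point.some x' y' h' ∧
      (2 * l + a) * (2 * y + a * x + a * b) = halfDeriv a b x ∧
      4 * x' = (2 * l + a) ^ 2 - (a ^ 2 + 4 * b) - 8 * x ∧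
      y' = -(y + l * (x' - x)) - a * x' - a * b := by
  have hy : y ≠ V.toAffine.negY x y := by
    rw [curve_negY hV]
    intro h0
    exact hg (by linear_combination h0)
  refine ⟨V.toAffine.slope x x y y, _, _, _, Point.add_self_of_Y_ne hy, ?_, ?_, ?_⟩
  · have hs : V.toAffine.slope x x y y * (2 * y + a * x + a * b) =
        3 * x ^ 2 + 2 * b * x - a * y := by
      rw [slope_of_Y_ne rfl hy, curve_negY hV,
        show y - (-y - a * x - a * b) = 2 * y + a * x + a * b by ring, div_mul_cancel₀ _ hg]
      subst hV
      simp only [curve, add_zero]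
    simp only [halfDeriv]
    linear_combination 2 * hs
  · subst hV
    simp only [addX, curve]
    ring
  · rw [addY, curve_negY hV, negAddY]
    ring

lemma add_eq (hV : V = curve a b) {x y x₁ y₁ : F} (h : V.toAffine.Nonsingular x y)
    (h₁ : V.toAffine.Nonsingular x₁ y₁) (hx : x ≠ x₁) :
    ∃ (l x' y' : F) (h' : V.toAffine.Nonsingular x' y'),
      Point.some x y h + Point.some x₁ y₁ h₁ = Point.some x' y' h' ∧
      l * (x - x₁) = y - y₁ ∧ x' = l ^ 2 + a * l - b - x - x₁ ∧
      y' = -(y + l * (x' - x)) - a * x' - a * b := by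
  refine ⟨V.toAffine.slope x x₁ y y₁, _, _, _, Point.add_of_X_ne hx, ?_, ?_, ?_⟩
  · rw [slope_of_X_ne hx, div_mul_cancel₀ _ (sub_ne_zero.mpr hx)]
  · subst hV
    rfl
  · rw [addY, curve_negY hV, negAddY]
    ring

lemma two_torsion (hV : V = curve a b) {x y : F} (h : V.toAffine.Nonsingular x y)
    (hg : 2 * y + a * x + a * b = 0) : Point.some x y h + Point.some x y h = 0 := by
  apply Point.add_self_of_Y_eq
  rw [curve_negY hV]
  linear_combination hg

/-- If ψ₃ vanishes, then 2P and P have the same x-coordinate, so 2P = ±P; and 2P = P would force P =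
0. -/
lemma three_torsion (hV : V = curve a b) {x y : F} (h : V.toAffine.Nonsingular x y)
    (h2 : (2 : F) ≠ 0) (h0 : threeDivPoly a b x = 0) : 3 • Point.some x y h = 0 := by
  have e := (curve_equation_iff hV).mp h.1
  have hg : 2 * y + a * x + a * b ≠ 0 := fun hg => threeDivPoly_ne_zero hV h h2 hg h0
  obtain ⟨l, x', y', h', hP, hl, hx', hy'⟩ := add_self_eq hV h hg
  have hx := add_self_x h2 (sq_eq_twoDivPoly e) hl hx'
  rw [h0, neg_zero, mul_eq_zero, or_iff_left (pow_ne_zero 2 hg), sub_eq_zero] at hx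
  rcases (Point.X_eq_iff (h₁ := h') (h₂ := h)).mp hx with h1 | h1
  · rw [← hP] at h1
    exact absurd (add_eq_left.mp h1) (Point.some_ne_zero h)
  · rw [← hP] at h1
    rw [succ_nsmul, two_nsmul, h1, neg_add_cancel]

/-- The condition on y' is stated through the odd function 2y + ax + ab because that is the form in
which the isogenies transport it. -/
lemma neg_three_smul (hV : V = curve a b) {x y x' y' : F} (h : V.toAffine.Nonsingular x y)
    (h' : V.toAffine.Nonsingular x' y') (h2 : (2 : F) ≠ 0) (h0 : threeDivPoly a b x ≠ 0)
    (hx' : (x' - x) * threeDivPoly a b x ^ 2 = -(twoDivPoly a b x * fourDivPoly a b x))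
    (hy' : (2 * y' + a * x' + a * b) * threeDivPoly a b x ^ 3 = (2 * y + a * x + a * b) *
      (threeDivPoly a b x ^ 3 - (2 * twoDivPoly a b x ^ 2 - halfDeriv a b x * threeDivPoly a b x) *
        fourDivPoly a b x)) :
    (-3 : ℤ) • Point.some x y h = Point.some x' y' h' := by
  have e := (curve_equation_iff hV).mp h.1
  have hsq := sq_eq_twoDivPoly e
  have h4 : (4 : F) ≠ 0 := by
    have := mul_ne_zero h2 h2
    norm_num at this
    exact this
  have h3 : (-3 : ℤ) • Point.some x y h =
      -((Point.some x y h + Point.some x y h) + Point.some x y h) := by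
    rw [neg_smul]; congr 1
    rw [← two_zsmul, ← add_one_zsmul]; rfl
  rw [h3]
  by_cases hg : 2 * y + a * x + a * b = 0
  · rw [two_torsion hV h hg, zero_add, Point.neg_some]
    rw [← hsq, hg, zero_pow two_ne_zero, zero_mul, neg_zero, mul_eq_zero,
      or_iff_left (pow_ne_zero 2 h0), sub_eq_zero] at hx'
    rw [hg, zero_mul, mul_eq_zero, or_iff_left (pow_ne_zero 3 h0)] at hy'
    subst hx'
    apply some_congr rfl
    rw [curve_negY hV]
    apply mul_left_cancel₀ h2
    linear_combination -2 * hg + hg - hy'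
  · obtain ⟨l, x₂, y₂, h₂, hP, hl, hx₂, hy₂⟩ := add_self_eq hV h hg
    have hx := add_self_x h2 hsq hl hx₂
    have hne : x₂ ≠ x := by
      rintro rfl
      apply h0
      linear_combination hx
    obtain ⟨m, x₃, y₃, h₃, hQ, hm, hx₃, hy₃⟩ := add_eq hV h₂ h hne
    rw [hP, hQ, neg_eq_iff_eq_neg, Point.neg_some]
    generalize hgg : 2 * y + a * x + a * b = g at *
    generalize hT : threeDivPoly a b x = T at *
    generalize hf : twoDivPoly a b x = f at *
    generalize hhf : halfDeriv a b x = d at *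
    generalize hp : fourDivPoly a b x = p at *
    have hdi := division_identity a b x
    rw [hT, hf, hhf, hp] at hdi
    -- This ties the slope m of the line through 2P and P to the tangent slope l, so that m can be
    -- expressed by f, f'/2, ψ₃ and g.
    have hB : (m + l + a) * (x₂ - x) = -g := by
      linear_combination hm + hy₂ - hgg
    have hA : (m + l + a) * T = g ^ 3 := by
      linear_combination (m + l + a) * hx - g ^ 2 * hB
    have hm' : (2 * m + a) * T * g = 2 * f ^ 2 - d * T := by
      linear_combination 2 * g * hA - T * hl + 2 * (g ^ 2 + f) * hsq
    have hx3 : x₃ = x' := by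
      have hc : 4 * T ^ 2 * g ^ 2 ≠ 0 := mul_ne_zero (mul_ne_zero h4 (pow_ne_zero 2 h0))
        (pow_ne_zero 2 hg)
      apply mul_left_cancel₀ hc
      linear_combination 4 * T ^ 2 * g ^ 2 * hx₃ + ((2 * m + a) * T * g + (2 * f ^ 2 - d * T)) * hm'
        + hdi - 4 * T ^ 2 * hx - 4 * g ^ 2 * hx'
        - (T ^ 2 * (a ^ 2 + 4 * b + 12 * x) - 4 * f * p) * hsq
    apply some_congr hx3
    rw [curve_negY hV]
    have hc : 2 * T ^ 3 * g ≠ 0 := mul_ne_zero (mul_ne_zero h2 (pow_ne_zero 3 h0)) hg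
    apply mul_left_cancel₀ hc
    linear_combination 2 * T ^ 3 * g * (hy₃ + hm) - 2 * T ^ 3 * g * (m + a) * hx3 + g * hy'
      - T ^ 3 * g * hgg - T ^ 2 * (x' - x) * hm' - (2 * f ^ 2 - d * T) * hx'
      - (2 * f ^ 2 - d * T) * p * hsq

end tripling

/-! ### The composite of the isogeny and its dual -/

section composite

-- In the variable t = x/b everything depends only on s and s' with ss' = -3; here `al` is a²/b, `c`
-- is k²/b, and tq/H² is the rescaled x-coordinate of the image. The three identities match the
-- denominator, the x-coordinate and the multiplier of 2y + ax + ab with those of multiplication by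
-- -3.
set_option maxRecDepth 4000 in
set_option maxHeartbeats 1000000 in
lemma composite_aux {R : Type} [CommRing R] {t s s' w w' H q T p f A c e al : R}
    (h : s * s' = -3) (hw : w = 1 + s) (hw' : w' = 1 + s') (hal : al = -(w ^ 3 * w'))
    (hc : c = -(w * w')) (hH : H = w + s * t) (hq : q = t ^ 2 + w * (4 - w) * t + w * (4 - w))
    (hT : T = 3 * t ^ 4 + (al + 4) * t ^ 3 + 3 * al * t ^ 2 + 3 * al * t + al)
    (hf : f = 4 * t ^ 3 + (al + 4) * t ^ 2 + 2 * al * t + al)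
    (hp : p = 2 * t ^ 6 + (al + 4) * t ^ 5 + 5 * al * t ^ 4 + 10 * al * t ^ 3 + 10 * al * t ^ 2
      + 4 * al * t)
    (he : e = 6 * t ^ 2 + (al + 4) * t + al) (hA : A = (t + w) * (t ^ 2 + c * (t + 1))) :
    H * (w' * H ^ 2 + s' * (t * q)) = -T ∧
    t * q * ((t * q) ^ 2 + w' * (4 - w') * (t * q) * H ^ 2 + w' * (4 - w') * H ^ 4) =
      t * T ^ 2 - f * p ∧
    A * ((t * q + w' * H ^ 2) * ((t * q) ^ 2 + c * (t * q + H ^ 2) * H ^ 2)) =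
      (2 * f ^ 2 - e * T) * p - T ^ 3 := by
  subst_vars
  refine ⟨by grind, by grind, by grind⟩

end composite

section composite

variable {F : Type} [Field F] {a b κ k w w' κ' : F}

/-- The coordinates of the image of a point under the isogeny and its dual. -/
lemma composite_coordinates (h : Admissible a b κ k w w') (hκ : b ^ 3 * κ' = w' - 1) {x y X₁ Y₁ : F}
    (e : y ^ 2 + a * x * y + a * b * y = x ^ 3 + b * x ^ 2) (hH : den κ w x ≠ 0)
    (hX : den κ w x ^ 2 * X₁ = numX b w x) (hY : den κ w x ^ 3 * Y₁ = numY b k w x y) :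
    den κ' w' X₁ * den κ w x ^ 3 * b ^ 4 = -threeDivPoly a b x ∧
    ∀ x' y' : F, den κ' w' X₁ ^ 2 * (b ^ 8 * x') = numX (b ^ 3) w' X₁ →
      den κ' w' X₁ ^ 3 * (b ^ 12 * y') = numY (b ^ 3) (-(b * k)) w' X₁ Y₁ →
      (x' - x) * threeDivPoly a b x ^ 2 = -(twoDivPoly a b x * fourDivPoly a b x) ∧
      (2 * y' + a * x' + a * b) * threeDivPoly a b x ^ 3 = (2 * y + a * x + a * b) *
        (threeDivPoly a b x ^ 3 - (2 * twoDivPoly a b x ^ 2 - halfDeriv a b x * threeDivPoly a b x) *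
          fourDivPoly a b x) := by
  have hb := h.isUnit_b.ne_zero
  have h' := h.dual rfl rfl hκ
  have n1 := numY_add_numY h e
  have e' : Y₁ ^ 2 + -(b * w' * k) * X₁ * Y₁ + -(b * w' * k) * b ^ 3 * Y₁ = X₁ ^ 3 + b ^ 3 * X₁ ^ 2 := by
    have := num_equation h e
    rw [← hX, ← hY] at this
    apply mul_left_cancel₀ (pow_ne_zero 6 hH)
    linear_combination this
  have n2 := numY_add_numY h' e'
  -- Homogeneity: dividing x by b and X₁ by b³ removes b from the identities.
  obtain ⟨t, rfl⟩ : ∃ t, x = b * t := ⟨x / b, by field_simp⟩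
  obtain ⟨u, rfl⟩ : ∃ u, X₁ = b ^ 3 * u := ⟨X₁ / b ^ 3, by field_simp⟩
  have ha2 : a ^ 2 = -(w ^ 3 * w') * b := by
    rw [h.a_eq]; linear_combination w ^ 2 * h.k_sq
  have hden : den κ w (b * t) = w + (w - 1) * t := by
    simp only [den]; linear_combination t * h.b_mul
  have hden' : den κ' w' (b ^ 3 * u) = w' + (w' - 1) * u := by
    simp only [den]; linear_combination u * hκ
  obtain ⟨i1, i2, i3⟩ := composite_aux (t := t) (s := w - 1) (s' := w' - 1) (w := w) (w' := w')
    (by linear_combination -h.w_add) (by ring) (by ring) rfl rfl rfl rfl rfl rfl rfl rfl rfl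
  have f1 : threeDivPoly a b (b * t) = b ^ 4 * (3 * t ^ 4 + (-(w ^ 3 * w') + 4) * t ^ 3 +
      3 * -(w ^ 3 * w') * t ^ 2 + 3 * -(w ^ 3 * w') * t + -(w ^ 3 * w')) := by
    simp only [threeDivPoly]
    linear_combination b ^ 3 * (t ^ 3 + 3 * t ^ 2 + 3 * t + 1) * ha2
  have f2 : twoDivPoly a b (b * t) = b ^ 3 * (4 * t ^ 3 + (-(w ^ 3 * w') + 4) * t ^ 2 +
      2 * -(w ^ 3 * w') * t + -(w ^ 3 * w')) := by
    simp only [twoDivPoly]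
    linear_combination b ^ 2 * (t ^ 2 + 2 * t + 1) * ha2
  have f3 : halfDeriv a b (b * t) = b ^ 2 * (6 * t ^ 2 + (-(w ^ 3 * w') + 4) * t +
      -(w ^ 3 * w')) := by
    simp only [halfDeriv]
    linear_combination b * (t + 1) * ha2
  have f4 : fourDivPoly a b (b * t) = b ^ 6 * (2 * t ^ 6 + (-(w ^ 3 * w') + 4) * t ^ 5 +
      5 * -(w ^ 3 * w') * t ^ 4 + 10 * -(w ^ 3 * w') * t ^ 3 + 10 * -(w ^ 3 * w') * t ^ 2 +
      4 * -(w ^ 3 * w') * t) := by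
    simp only [fourDivPoly]
    linear_combination b ^ 5 * (t ^ 5 + 5 * t ^ 4 + 10 * t ^ 3 + 10 * t ^ 2 + 4 * t) * ha2
  have hX' : (w + (w - 1) * t) ^ 2 * u = t * (t ^ 2 + w * (4 - w) * t + w * (4 - w)) := by
    apply mul_left_cancel₀ (pow_ne_zero 3 hb)
    rw [hden] at hX
    simp only [numX] at hX
    linear_combination hX
  rw [← hX, ← hY, hden] at n1
  rw [f1, f2, f3, f4, hden, hden']
  rw [hden] at hH
  rw [hden'] at n2
  generalize w + (w - 1) * t = H at *
  generalize t ^ 2 + w * (4 - w) * t + w * (4 - w) = q at *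
  generalize 3 * t ^ 4 + (-(w ^ 3 * w') + 4) * t ^ 3 +
      3 * -(w ^ 3 * w') * t ^ 2 + 3 * -(w ^ 3 * w') * t + -(w ^ 3 * w') = T at *
  generalize 4 * t ^ 3 + (-(w ^ 3 * w') + 4) * t ^ 2 +
      2 * -(w ^ 3 * w') * t + -(w ^ 3 * w') = f at *
  generalize 6 * t ^ 2 + (-(w ^ 3 * w') + 4) * t + -(w ^ 3 * w') = d at *
  generalize 2 * t ^ 6 + (-(w ^ 3 * w') + 4) * t ^ 5 +
      5 * -(w ^ 3 * w') * t ^ 4 + 10 * -(w ^ 3 * w') * t ^ 3 + 10 * -(w ^ 3 * w') * t ^ 2 +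
      4 * -(w ^ 3 * w') * t = p at *
  have i0 : (w' + (w' - 1) * u) * H ^ 3 = -T := by
    linear_combination i1 + H * (w' - 1) * hX'
  refine ⟨by linear_combination b ^ 4 * i0, fun x' y' hx' hy' => ?_⟩
  rw [← hx', ← hy'] at n2
  generalize hDD : w' + (w' - 1) * u = D at *
  have hT : T = -(D * H ^ 3) := by linear_combination i0
  simp only [numX] at hx'
  have hx2 : D ^ 2 * x' = b * (u * (u ^ 2 + w' * (4 - w') * u + w' * (4 - w'))) := by
    apply mul_left_cancel₀ (pow_ne_zero 8 hb)
    linear_combination hx'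
  have hk2 : k ^ 2 = b * -(w * w') := by linear_combination h.k_sq
  generalize 2 * y + a * (b * t) + a * b = g at *
  have n1' : (2 * Y₁ + -(b * w' * k) * (b ^ 3 * u) + -(b * w' * k) * b ^ 3) * H ^ 3 =
      g * b ^ 3 * ((t + w) * (t ^ 2 + -(w * w') * (t + 1))) := by
    linear_combination n1 + g * b ^ 2 * (t + w) * (t + 1) * hk2
  generalize 2 * Y₁ + -(b * w' * k) * (b ^ 3 * u) + -(b * w' * k) * b ^ 3 = G at *
  have n2' : D ^ 3 * b ^ 3 * (2 * y' + a * x' + a * b) =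
      G * ((u + w') * (u ^ 2 + -(w * w') * (u + 1))) := by
    apply mul_left_cancel₀ (pow_ne_zero 9 hb)
    linear_combination n2 + G * b ^ 8 * (u + w') * (u + 1) * hk2
      + D ^ 3 * b ^ 12 * (x' + b) * h.a_eq
  rw [← hX'] at i2 i3
  refine ⟨?_, ?_⟩
  · linear_combination b ^ 8 * (x' * (T - D * H ^ 3) * hT + H ^ 6 * hx2 + b * i2)
  · apply mul_left_cancel₀ (pow_ne_zero 3 hb)
    linear_combination b ^ 15 * (2 * y' + a * x' + a * b) *
        (T ^ 2 - T * (D * H ^ 3) + (D * H ^ 3) ^ 2) * hT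
      - b ^ 12 * H ^ 9 * n2' - b ^ 12 * (u + w') * (u ^ 2 + -(w * w') * (u + 1)) * H ^ 6 * n1'
      - b ^ 15 * g * i3

end composite

/-! ### The product formula -/

section product

variable {R : Type} [CommRing R] {x y k w r a b d c s m q n : R}

/-- With r = 1/κ, the quotients s/d and m/d are the sum and the product of the slopes l of the lines
from P to ±Q. The left side is d² times the product of the two values l² + al - c, the x-coordinates
of P ± Q. -/
lemma product_identity_x (hk : k ^ 2 = w * (4 - w) * r)
    (e : y ^ 2 + a * x * y + a * b * y = x ^ 3 + b * x ^ 2) (ha : a = k * w) (hb : b = (w - 1) * r)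
    (hd : d = x + w * r) (hc : c = x - r) (hs : s = 2 * y - a * r)
    (hm : m = x ^ 2 - r * x + w * r ^ 2 - a * y)
    (hq : q = x ^ 2 + b * w * (4 - w) * x + b ^ 2 * w * (4 - w)) :
    m ^ 2 + a * m * s - c * (s ^ 2 - 2 * d * m) + a ^ 2 * d * m - a * c * d * s + c ^ 2 * d ^ 2 =
      w ^ 2 * r ^ 2 * q := by
  subst_vars
  linear_combination (-4 * x - k ^ 2 * w ^ 2 + 4 * r) * e + (x * w ^ 3 * r ^ 2 - x * w ^ 2 * r ^ 2
    + w ^ 4 * r ^ 3 - 2 * w ^ 3 * r ^ 3 + w ^ 2 * r ^ 3) * hk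

/-- The y-coordinates of P ± Q are -(l³ + 2al² + ul + v) for the two slopes l, and the left side is
d³ times their product. -/
lemma product_identity_y (e : y ^ 2 + a * x * y + a * b * y = x ^ 3 + b * x ^ 2)
    (ha : a = k * w) (hb : b = (w - 1) * r)
    (hd : d = x + w * r) (hc : c = x - r) (hs : s = 2 * y - a * r)
    (hm : m = x ^ 2 - r * x + w * r ^ 2 - a * y)
    (hn : n = x ^ 2 + k * (w - 2) * y + k ^ 2 * (w - 1) ^ 2 * (x + b)) {u v : R}
    (hu : u = a ^ 2 - c - x) (hv : v = y + a * b - a * c) :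
    m ^ 3 + 2 * a * m ^ 2 * s + u * m * (s ^ 2 - 2 * d * m) + v * (s ^ 3 - 3 * d * m * s)
      + 4 * a ^ 2 * d * m ^ 2 + 2 * a * u * d * m * s + 2 * a * v * d * (s ^ 2 - 2 * d * m)
      + u ^ 2 * d ^ 2 * m + u * v * d ^ 2 * s + v ^ 2 * d ^ 3 =
      w ^ 2 * r ^ 3 * ((x + b * w) * n) := by
  subst_vars
  linear_combination (8 * y ^ 2 + 6 * y * x * k * w - y * k ^ 3 * w ^ 3 + 14 * y * k * w ^ 2 * r
    - 8 * y * k * w * r - 9 * x ^ 3 - 3 * x ^ 2 * k ^ 2 * w ^ 2 - 3 * x ^ 2 * w * r + 12 * x ^ 2 * r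
    - x * k ^ 4 * w ^ 4 + 4 * x * k ^ 2 * w ^ 3 * r + 2 * x * k ^ 2 * w ^ 2 * r - x * w ^ 2 * r ^ 2
    - 4 * x * w * r ^ 2 - 4 * x * r ^ 2 - k ^ 4 * w ^ 5 * r + k ^ 4 * w ^ 4 * r
    + 6 * k ^ 2 * w ^ 4 * r ^ 2 - 8 * k ^ 2 * w ^ 3 * r ^ 2 + 2 * k ^ 2 * w ^ 2 * r ^ 2
    + w ^ 3 * r ^ 3 - 4 * w ^ 2 * r ^ 3 + 4 * w * r ^ 3) * e

/-- The products of the coordinates of `P - Q` and `P + Q`. -/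
lemma product_coordinates {F : Type} [Field F] {x y z k w r a b x₁ y₁ x₂ y₂ l₁ l₂ : F}
    (hk : k ^ 2 = w * (4 - w) * r) (hz : z ^ 2 = k * w * r * z - w ^ 2 * r ^ 3)
    (e : y ^ 2 + a * x * y + a * b * y = x ^ 3 + b * x ^ 2) (ha : a = k * w) (hb : b = (w - 1) * r)
    (hd : x + w * r ≠ 0)
    (hl₁ : l₁ * (x + w * r) = y - (k * w * r - z)) (hl₂ : l₂ * (x + w * r) = y - z)
    (hx₁ : x₁ = l₁ ^ 2 + a * l₁ - b - x + w * r) (hx₂ : x₂ = l₂ ^ 2 + a * l₂ - b - x + w * r)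
    (hy₁ : y₁ = -(y + l₁ * (x₁ - x)) - a * x₁ - a * b)
    (hy₂ : y₂ = -(y + l₂ * (x₂ - x)) - a * x₂ - a * b) :
    x₁ * x₂ * (x + w * r) ^ 2 =
      w ^ 2 * r ^ 2 * (x ^ 2 + b * w * (4 - w) * x + b ^ 2 * w * (4 - w)) ∧
    y₁ * y₂ * (x + w * r) ^ 3 = w ^ 2 * r ^ 3 *
      ((x + b * w) * (x ^ 2 + k * (w - 2) * y + k ^ 2 * (w - 1) ^ 2 * (x + b))) := by
  have i1 := product_identity_x hk e ha hb rfl rfl rfl rfl rfl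
  have i2 := product_identity_y e ha hb rfl rfl rfl rfl rfl rfl rfl
  rw [← i1, ← i2]
  have hs : 2 * y - a * r = (l₁ + l₂) * (x + w * r) := by
    rw [ha]; linear_combination -hl₁ - hl₂
  -- By the curve equation, (y - y(Q))(y - y(-Q)) is divisible by x - x(Q) = x + wr, with quotient
  -- m.
  have hm : x ^ 2 - r * x + w * r ^ 2 - a * y = l₁ * l₂ * (x + w * r) := by
    apply mul_left_cancel₀ hd
    have h1 : l₁ * l₂ * (x + w * r) ^ 2 = (y - (k * w * r - z)) * (y - z) := by
      rw [← hl₁, ← hl₂]; ring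
    subst ha hb
    linear_combination -h1 - e + hz
  have hc : b + x - w * r = x - r := by rw [hb]; ring
  rw [hs, hm]
  have hx₁' : x₁ = l₁ ^ 2 + a * l₁ - (x - r) := by rw [hx₁]; linear_combination -hc
  have hx₂' : x₂ = l₂ ^ 2 + a * l₂ - (x - r) := by rw [hx₂]; linear_combination -hc
  rw [hy₁, hy₂, hx₁', hx₂']
  constructor <;> ring

end product

/-! ### Points of the family over a field -/

section points

variable {R : Type} [CommRing R] {L : Type} [Field L] [Algebra R L]

lemma baseChange_curve (a b : R) :
    (curve a b)⁄L = curve (algebraMap R L a) (algebraMap R L b) := by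
  simp only [WeierstrassCurve.baseChange, WeierstrassCurve.map, curve, map_mul, map_zero]

lemma nonsingular_curve {a b : R} [(curve a b).IsElliptic] {x y : L}
    (e : y ^ 2 + algebraMap R L a * x * y + algebraMap R L a * algebraMap R L b * y =
      x ^ 3 + algebraMap R L b * x ^ 2) : ((curve a b)⁄L).toAffine.Nonsingular x y := by
  have : ((curve a b)⁄L).toAffine.IsElliptic :=
    inferInstanceAs ((curve a b).map (algebraMap R L)).IsElliptic
  exact equation_iff_nonsingular.mp ((curve_equation_iff (baseChange_curve a b)).mpr e)

/-- The points at which the denominator of the isogeny vanishes, and the identity. -/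
def IsInKernel (κ w : R) {E : WeierstrassCurve R} : (E⁄L).toAffine.Point → Prop
  | .zero => True
  | .some x _ _ => den (algebraMap R L κ) (algebraMap R L w) x = 0

variable {b κ k w : R} {E E' : WeierstrassCurve R} {ψ : overBase E ⟶ overBase E'}

lemma IsGivenByFormulas.point_of_isInKernel (hψ : IsGivenByFormulas b κ k w ψ)
    {P : (E⁄L).toAffine.Point} (hP : IsInKernel κ w P) :
    point P ≫ ψ.left = point (0 : (E'⁄L).toAffine.Point) := by
  rcases P with _ | ⟨x, y, h⟩
  · exact (hψ L).1
  · exact ((hψ L).2 x y h).1 hP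

/-- The image of a point outside the kernel. -/
lemma IsGivenByFormulas.exists_image {a w' a' b' : R}
    {ψ : overBase (curve a b) ⟶ overBase (curve a' b')}
    (hψ : IsGivenByFormulas b κ k w ψ) (h : Admissible a b κ k w w') (ha' : a' = -(b * w' * k))
    (hb' : b' = b ^ 3) [(curve a' b').IsElliptic] {x y : L}
    (hP : ((curve a b)⁄L).toAffine.Nonsingular x y)
    (hd : den (algebraMap R L κ) (algebraMap R L w) x ≠ 0) :
    ∃ (X₁ Y₁ : L) (h' : ((curve a' b')⁄L).toAffine.Nonsingular X₁ Y₁),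
      den (algebraMap R L κ) (algebraMap R L w) x ^ 2 * X₁ =
        numX (algebraMap R L b) (algebraMap R L w) x ∧
      den (algebraMap R L κ) (algebraMap R L w) x ^ 3 * Y₁ =
        numY (algebraMap R L b) (algebraMap R L k) (algebraMap R L w) x y ∧
      point (.some x y hP) ≫ ψ.left = point (.some X₁ Y₁ h') := by
  have e := (curve_equation_iff (baseChange_curve a b)).mp hP.1
  have hn := num_equation (h.map (algebraMap R L)) e
  have hX : den (algebraMap R L κ) (algebraMap R L w) x ^ 2 *
      (numX (algebraMap R L b) (algebraMap R L w) x / den (algebraMap R L κ) (algebraMap R L w) x ^ 2) =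
        numX (algebraMap R L b) (algebraMap R L w) x := mul_div_cancel₀ _ (pow_ne_zero 2 hd)
  have hY : den (algebraMap R L κ) (algebraMap R L w) x ^ 3 *
      (numY (algebraMap R L b) (algebraMap R L k) (algebraMap R L w) x y /
        den (algebraMap R L κ) (algebraMap R L w) x ^ 3) =
      numY (algebraMap R L b) (algebraMap R L k) (algebraMap R L w) x y :=
    mul_div_cancel₀ _ (pow_ne_zero 3 hd)
  generalize numX (algebraMap R L b) (algebraMap R L w) x /
    den (algebraMap R L κ) (algebraMap R L w) x ^ 2 = X₁ at hX
  generalize numY (algebraMap R L b) (algebraMap R L k) (algebraMap R L w) x y /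
    den (algebraMap R L κ) (algebraMap R L w) x ^ 3 = Y₁ at hY
  have hns : ((curve a' b')⁄L).toAffine.Nonsingular X₁ Y₁ := by
    apply nonsingular_curve
    apply mul_left_cancel₀ (pow_ne_zero 6 hd)
    rw [← hX, ← hY] at hn
    simp only [ha', hb', map_neg, map_mul, map_pow]
    linear_combination hn
  exact ⟨X₁, Y₁, hns, hX, hY, ((hψ L).2 x y hP).2 X₁ Y₁ hns hd hX hY⟩

end points

/-! ### Generators of the subgroup of order three -/

section torsion

variable {F : Type} [Field F] {a b : F} {V : WeierstrassCurve F}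

lemma threeDivPoly_eq_zero_of_den {κ k w w' x : F} (h : Admissible a b κ k w w')
    (hd : den κ w x = 0) : threeDivPoly a b x = 0 := by
  have hb := h.isUnit_b.ne_zero
  obtain ⟨t, rfl⟩ : ∃ t, x = b * t := ⟨x / b, by field_simp⟩
  have ha2 : a ^ 2 = -(w ^ 3 * w') * b := by
    rw [h.a_eq]; linear_combination w ^ 2 * h.k_sq
  obtain ⟨i1, -, -⟩ := composite_aux (t := t) (s := w - 1) (s' := w' - 1) (w := w) (w' := w')
    (by linear_combination -h.w_add) (by ring) (by ring) rfl rfl rfl rfl rfl rfl rfl rfl rfl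
  have hden : w + (w - 1) * t = 0 := by
    rw [← hd]; simp only [den]; linear_combination -t * h.b_mul
  rw [hden, zero_mul] at i1
  simp only [threeDivPoly]
  linear_combination b ^ 3 * (t ^ 3 + 3 * t ^ 2 + 3 * t + 1) * ha2 + b ^ 4 * i1

/-- A point of order three has parameter `κ` if and only if the denominator of the isogeny
vanishes. -/
lemma parameter_eq_iff {κ k w w' x y : F} (h : Admissible a b κ k w w')
    (e : y ^ 2 + a * x * y + a * b * y = x ^ 3 + b * x ^ 2) (hT : threeDivPoly a b x = 0) :
    κ = a * (1 / y) - (x / y) ^ 2 ↔ den κ w x = 0 := by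
  have hb := h.isUnit_b.ne_zero
  have ha := h.isUnit_a.ne_zero
  -- The third division polynomial is a²b³ at 0 and -b⁴ at -b, so x and x + b are nonzero, and hence
  -- so is y.
  have hx : x ≠ 0 := by
    rintro rfl
    apply mul_ne_zero (pow_ne_zero 2 ha) (pow_ne_zero 3 hb)
    rw [← hT]; simp only [threeDivPoly]; ring
  have hxb : x + b ≠ 0 := by
    intro h0
    obtain rfl : x = -b := by linear_combination h0
    apply pow_ne_zero 4 hb
    simp only [threeDivPoly] at hT
    linear_combination -hT
  have hy : y ≠ 0 := by
    rintro rfl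
    apply mul_ne_zero (pow_ne_zero 2 hx) hxb
    linear_combination -e
  have h1 : κ = a * (1 / y) - (x / y) ^ 2 ↔ κ * y ^ 2 = a * y - x ^ 2 := by
    rw [show a * (1 / y) - (x / y) ^ 2 = (a * y - x ^ 2) / y ^ 2 by field_simp,
      eq_div_iff (pow_ne_zero 2 hy)]
  rw [h1, den]
  -- Multiplying κy² = ay - x² by x + b and using the curve equation gives κ(x + b) = -1, which is w
  -- + κx = 0.
  constructor
  · intro h0
    apply (mul_eq_zero_iff_right (pow_ne_zero 2 hy)).mp
    linear_combination (x + b) * h0 - y ^ 2 * h.b_mul + e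
  · intro h0
    apply mul_right_cancel₀ hxb
    linear_combination y ^ 2 * h0 + y ^ 2 * h.b_mul - e

lemma exists_equation [IsAlgClosed F] (h2 : (2 : F) ≠ 0) (a b x : F) :
    ∃ y, y ^ 2 + a * x * y + a * b * y = x ^ 3 + b * x ^ 2 := by
  obtain ⟨g, hg⟩ := IsAlgClosed.exists_pow_nat_eq (twoDivPoly a b x) (n := 2) two_pos
  obtain ⟨y, rfl⟩ : ∃ y, g = 2 * y + a * x + a * b := ⟨(g - a * x - a * b) / 2, by field_simp; ring⟩
  refine ⟨y, mul_left_cancel₀ (mul_ne_zero h2 h2) ?_⟩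
  simp only [twoDivPoly] at hg
  linear_combination hg

variable [DecidableEq F]

lemma threeDivPoly_eq_zero (hV : V = curve a b) {x y : F} (h : V.toAffine.Nonsingular x y)
    (h2 : (2 : F) ≠ 0) (h3 : 3 • Point.some x y h = 0) : threeDivPoly a b x = 0 := by
  have e := (curve_equation_iff hV).mp h.1
  rw [succ_nsmul, two_nsmul] at h3
  by_cases hg : 2 * y + a * x + a * b = 0
  · rw [two_torsion hV h hg, zero_add] at h3
    exact absurd h3 (Point.some_ne_zero h)
  · obtain ⟨l, x', y', h', hP, hl, hx', hy'⟩ := add_self_eq hV h hg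
    have hx := add_self_x h2 (sq_eq_twoDivPoly e) hl hx'
    rw [hP, add_eq_zero_iff_eq_neg] at h3
    have hxx : x' = x := (Point.X_eq_iff (h₁ := h') (h₂ := h)).mpr (Or.inr h3)
    rw [hxx, sub_self, zero_mul] at hx
    exact neg_eq_zero.mp hx.symm

end torsion

section generators

variable {R : Type} [CommRing R] {L : Type} [Field L] [Algebra R L] {a b κ k w w' : R}

/-- This is the infinitesimal case: the denominator is the constant w, a unit. -/
lemma isInKernel_iff_of_eq_zero (h : Admissible a b κ k w w') (hκ : algebraMap R L κ = 0)
    {P : ((curve a b)⁄L).toAffine.Point} : IsInKernel κ w P ↔ P = 0 := by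
  rcases P with _ | ⟨x, y, hP⟩
  · exact iff_of_true trivial rfl
  · refine iff_of_false ?_ (Point.some_ne_zero hP)
    change den (algebraMap R L κ) (algebraMap R L w) x ≠ 0
    rw [den, hκ, zero_mul, add_zero]
    exact (h.isUnit_w.map (algebraMap R L)).ne_zero

variable [DecidableEq L]

lemma isGenerator_some_iff (h : Admissible a b κ k w w') {x y : L}
    (hQ : ((curve a b)⁄L).toAffine.Nonsingular x y) :
    IsGenerator a b κ (.some x y hQ) ↔ den (algebraMap R L κ) (algebraMap R L w) x = 0 := by
  have e := (curve_equation_iff (baseChange_curve a b)).mp hQ.1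
  have hL := h.map (algebraMap R L)
  have h2 := hL.isUnit_two.ne_zero
  constructor
  · rintro ⟨h3, hp⟩
    exact (parameter_eq_iff hL e (threeDivPoly_eq_zero (baseChange_curve a b) hQ h2 h3)).mp hp
  · intro hd
    have hT := threeDivPoly_eq_zero_of_den hL hd
    exact ⟨three_torsion (baseChange_curve a b) hQ h2 hT, (parameter_eq_iff hL e hT).mpr hd⟩

lemma isGenerator_zero_iff :
    IsGenerator a b κ (0 : ((curve a b)⁄L).toAffine.Point) ↔ algebraMap R L κ = 0 := by
  have : algebraMap R L a * vCoord (0 : ((curve a b)⁄L).toAffine.Point) -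
      uCoord (0 : ((curve a b)⁄L).toAffine.Point) ^ 2 = 0 := by
    change algebraMap R L a * 0 - (0 : L) ^ 2 = 0
    ring
  rw [IsGenerator, this, and_iff_right (smul_zero 3)]

lemma isInKernel_iff_of_isGenerator (h : Admissible a b κ k w w')
    {P Q : ((curve a b)⁄L).toAffine.Point} (hQ : IsGenerator a b κ Q) :
    IsInKernel κ w P ↔ P = 0 ∨ P = Q ∨ P = -Q := by
  rcases Q with _ | ⟨x₁, y₁, hQ₁⟩
  · rw [isInKernel_iff_of_eq_zero h (isGenerator_zero_iff.mp hQ)]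
    change P = 0 ↔ P = 0 ∨ P = 0 ∨ P = -0
    simp
  · rcases P with _ | ⟨x, y, hP⟩
    · exact iff_of_true trivial (Or.inl rfl)
    · rw [or_iff_right (Point.some_ne_zero hP), ← Point.X_eq_iff]
      have hd := (isGenerator_some_iff h hQ₁).mp hQ
      have hw := (h.isUnit_w.map (algebraMap R L)).ne_zero
      change den (algebraMap R L κ) (algebraMap R L w) x = 0 ↔ _
      simp only [den] at hd ⊢
      have hκ : algebraMap R L κ ≠ 0 := by
        intro h0
        rw [h0, zero_mul, add_zero] at hd
        exact hw hd
      constructor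
      · intro h0
        apply mul_left_cancel₀ hκ
        linear_combination h0 - hd
      · rintro rfl
        exact hd

lemma mem_zmultiples_iff_of_three_nsmul {G : Type} [AddGroup G] {P Q : G} (h : 3 • Q = 0) :
    P ∈ AddSubgroup.zmultiples Q ↔ P = 0 ∨ P = Q ∨ P = -Q := by
  rw [AddSubgroup.mem_zmultiples_iff]
  constructor
  · rintro ⟨n, rfl⟩
    have h3 : (3 : ℤ) • Q = 0 := by exact_mod_cast h
    have h0 : n • Q = (n % 3) • Q := by
      conv_lhs => rw [← Int.emod_add_mul_ediv n 3, add_zsmul, mul_comm, mul_zsmul,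
        h3, zsmul_zero, add_zero]
    rw [h0]
    have hlt := Int.emod_lt_of_pos n (show (0 : ℤ) < 3 by norm_num)
    have hnn := Int.emod_nonneg n (show (3 : ℤ) ≠ 0 by norm_num)
    generalize n % 3 = r at *
    interval_cases r
    · exact Or.inl (zero_zsmul Q)
    · exact Or.inr (Or.inl (one_zsmul Q))
    · refine Or.inr (Or.inr (eq_neg_of_add_eq_zero_left ?_))
      rw [← add_one_zsmul]
      exact h3
  · rintro (rfl | rfl | rfl)
    · exact ⟨0, zero_zsmul Q⟩
    · exact ⟨1, one_zsmul _⟩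
    · exact ⟨-1, neg_one_zsmul Q⟩

/-- A generator exists on every geometric fibre. -/
lemma exists_isGenerator [IsAlgClosed L] (h : Admissible a b κ k w w') :
    ∃ Q : ((curve a b)⁄L).toAffine.Point, IsGenerator a b κ Q := by
  by_cases hκ : algebraMap R L κ = 0
  · exact ⟨0, isGenerator_zero_iff.mpr hκ⟩
  · have := h.isElliptic
    obtain ⟨x, hx⟩ : ∃ x : L, den (algebraMap R L κ) (algebraMap R L w) x = 0 :=
      ⟨-(algebraMap R L w / algebraMap R L κ), by simp only [den]; field_simp; ring⟩
    obtain ⟨y, hy⟩ := exists_equation (h.map (algebraMap R L)).isUnit_two.ne_zero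
      (algebraMap R L a) (algebraMap R L b) x
    exact ⟨.some x y (nonsingular_curve hy), (isGenerator_some_iff h _).mpr hx⟩

lemma isGenerator_iff [IsAlgClosed L] (h : Admissible a b κ k w w')
    (Q : ((curve a b)⁄L).toAffine.Point) :
    IsGenerator a b κ Q ↔ (AddSubgroup.zmultiples Q : Set ((curve a b)⁄L).toAffine.Point) =
      {P | IsInKernel κ w P} := by
  constructor
  · intro hQ
    ext P
    rw [SetLike.mem_coe, mem_zmultiples_iff_of_three_nsmul hQ.1, Set.mem_ofPred_eq,
      isInKernel_iff_of_isGenerator h hQ]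
  · intro hQ
    have hmem : IsInKernel κ w Q := by
      change Q ∈ {P | IsInKernel κ w P}
      rw [← hQ]
      exact AddSubgroup.mem_zmultiples Q
    rcases Q with _ | ⟨x, y, hQ₁⟩
    -- When the kernel has no point besides the identity, some generator exists and must itself be
    -- the identity.
    · obtain ⟨Q', hQ'⟩ := exists_isGenerator (L := L) h
      have : Q' ∈ {P | IsInKernel κ w P} :=
        (isInKernel_iff_of_isGenerator h hQ').mpr (Or.inr (Or.inl rfl))
      rw [← hQ, SetLike.mem_coe] at this
      change Q' ∈ AddSubgroup.zmultiples 0 at this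
      rw [AddSubgroup.zmultiples_zero_eq_bot, AddSubgroup.mem_bot] at this
      subst this
      exact hQ'
    · exact (isGenerator_some_iff h hQ₁).mpr hmem

end generators

/-! ### The isogeny is the universal isogeny -/

section universal

lemma isogeny_eq_product {F : Type} [Field F] [DecidableEq F] {a b κ k w w' : F}
    {V : WeierstrassCurve F} (hV : V = curve a b) (h : Admissible a b κ k w w')
    {x y xq yq x₁ y₁ x₂ y₂ X₁ Y₁ : F} (hP : V.toAffine.Nonsingular x y)
    (hQ : V.toAffine.Nonsingular xq yq) (h₁ : V.toAffine.Nonsingular x₁ y₁)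
    (h₂ : V.toAffine.Nonsingular x₂ y₂) (hdq : den κ w xq = 0) (hd : den κ w x ≠ 0)
    (hsub : Point.some x y hP - Point.some xq yq hQ = Point.some x₁ y₁ h₁)
    (hadd : Point.some x y hP + Point.some xq yq hQ = Point.some x₂ y₂ h₂)
    (hX : den κ w x ^ 2 * X₁ = numX b w x) (hY : den κ w x ^ 3 * Y₁ = numY b k w x y) :
    X₁ = x * x₁ * x₂ / w ^ 2 ∧ Y₁ = y * y₁ * y₂ / w ^ 2 := by
  have e := (curve_equation_iff hV).mp hP.1
  have eq := (curve_equation_iff hV).mp hQ.1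
  have hw := h.isUnit_w.ne_zero
  have hκ : κ ≠ 0 := by
    rintro rfl
    rw [den, zero_mul, add_zero] at hdq
    exact hw hdq
  -- In terms of r = 1/κ, the quantities x(Q), b and k² are polynomials in w and r.
  obtain ⟨r, hr⟩ : ∃ r, κ * r = 1 := ⟨κ⁻¹, mul_inv_cancel₀ hκ⟩
  have hxq : xq = -(w * r) := by
    simp only [den] at hdq
    linear_combination r * hdq - xq * hr
  have hb : b = (w - 1) * r := by linear_combination r * h.b_mul - b * hr
  have hk : k ^ 2 = w * (4 - w) * r := by
    linear_combination h.k_sq - w * w' * hb + w * r * h.w_add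
  have hden : den κ w x = κ * (x + w * r) := by
    simp only [den]; linear_combination -w * hr
  have hne : x ≠ xq := by
    rintro rfl
    exact hd hdq
  have hz : yq ^ 2 = k * w * r * yq - w ^ 2 * r ^ 3 := by
    rw [hxq, h.a_eq, hb] at eq
    linear_combination eq
  have hxqw : x - xq = x + w * r := by rw [hxq]; ring
  rw [hden] at hd hX hY
  have hd' : x + w * r ≠ 0 := right_ne_zero_of_mul hd
  rw [sub_eq_add_neg, Point.neg_some] at hsub
  obtain ⟨l₁, x₁', y₁', h₁', hs₁, hl₁, hx₁, hy₁⟩ := add_eq hV hP ((nonsingular_neg _ _).mpr hQ) hne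
  obtain ⟨l₂, x₂', y₂', h₂', hs₂, hl₂, hx₂, hy₂⟩ := add_eq hV hP hQ hne
  rw [hs₁, Point.some.injEq] at hsub
  rw [hs₂, Point.some.injEq] at hadd
  obtain ⟨rfl, rfl⟩ := hsub
  obtain ⟨rfl, rfl⟩ := hadd
  rw [curve_negY hV, hxqw] at hl₁
  rw [hxqw] at hl₂
  obtain ⟨i1, i2⟩ := product_coordinates hk hz e h.a_eq hb hd'
    (by rw [hl₁, hxq, h.a_eq, hb]; ring) hl₂ (by rw [hx₁, hxq]; ring) (by rw [hx₂, hxq]; ring)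
    hy₁ hy₂
  simp only [numX] at hX
  simp only [numY] at hY
  constructor
  · rw [eq_div_iff (pow_ne_zero 2 hw)]
    apply mul_left_cancel₀ (pow_ne_zero 2 hd)
    linear_combination w ^ 2 * hX - κ ^ 2 * x * i1 - w ^ 2 * x *
      (x ^ 2 + b * w * (4 - w) * x + b ^ 2 * w * (4 - w)) * (κ * r + 1) * hr
  · rw [eq_div_iff (pow_ne_zero 2 hw)]
    apply mul_left_cancel₀ (pow_ne_zero 3 hd)
    linear_combination w ^ 2 * hY - κ ^ 3 * y * i2 - w ^ 2 * (y * (x + b * w) *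
      (x ^ 2 + k * (w - 2) * y + k ^ 2 * (w - 1) ^ 2 * (x + b))) * (κ ^ 2 * r ^ 2 + κ * r + 1) * hr

variable {R : Type} [CommRing R] {a b κ k w w' a' b' : R}

lemma IsGivenByFormulas.isUniversalIsogeny {ψ : overBase (curve a b) ⟶ overBase (curve a' b')}
    (hψ : IsGivenByFormulas b κ k w ψ) (h : Admissible a b κ k w w') (ha' : a' = -(b * w' * k))
    (hb' : b' = b ^ 3) [(curve a' b').IsElliptic] : IsUniversalIsogeny a b κ ψ := by
  intro L _ _ _ _ Q P hQ
  refine ⟨fun hP => hψ.point_of_isInKernel ((isInKernel_iff_of_isGenerator h hQ).mpr hP), ?_⟩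
  rintro x₀ y₀ x₁ y₁ x₂ y₂ h₀ h₁ h₂ rfl hsub hadd
  have hL := h.map (algebraMap R L)
  have hd : den (algebraMap R L κ) (algebraMap R L w) x₀ ≠ 0 := by
    intro hd
    rcases (isInKernel_iff_of_isGenerator h (P := .some x₀ y₀ h₀) hQ).mp hd with h3 | h3 | h3
    · exact Point.some_ne_zero h₀ h3
    · rw [h3, sub_self] at hsub
      exact Point.some_ne_zero h₁ hsub.symm
    · rw [h3, neg_add_cancel] at hadd
      exact Point.some_ne_zero h₂ hadd.symm
  obtain ⟨X₁, Y₁, hns, hX, hY, hψP⟩ := hψ.exists_image h ha' hb' h₀ hd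
  have hw : 1 + algebraMap R L b * algebraMap R L κ = algebraMap R L w := by
    linear_combination hL.b_mul
  have key : X₁ = x₀ * x₁ * x₂ / (1 + algebraMap R L b * algebraMap R L κ) ^ 2 ∧
      Y₁ = y₀ * y₁ * y₂ / (1 + algebraMap R L b * algebraMap R L κ) ^ 2 := by
    rw [hw]
    rcases Q with _ | ⟨xq, yq, hq⟩
    -- Here Q = 0 and w = 1, so w + w' - ww' = 4 forces characteristic three, and the formulas
    -- reduce to (x³, y³).
    · have hκ : algebraMap R L κ = 0 := isGenerator_zero_iff.mp hQ
      change Point.some x₀ y₀ h₀ - 0 = _ at hsub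
      change Point.some x₀ y₀ h₀ + 0 = _ at hadd
      rw [sub_zero, Point.some.injEq] at hsub
      rw [add_zero, Point.some.injEq] at hadd
      obtain ⟨rfl, rfl⟩ := hsub
      obtain ⟨rfl, rfl⟩ := hadd
      have hw1 : algebraMap R L w = 1 := by rw [← hw, hκ, mul_zero, add_zero]
      have h3 : (3 : L) = 0 := by
        have := hL.w_add
        rw [hw1] at this
        linear_combination -this
      have e := (curve_equation_iff (baseChange_curve a b)).mp h₀.1
      rw [hκ, hw1, den, zero_mul, add_zero, one_pow, one_mul] at hX hY
      rw [hw1, one_pow, div_one, div_one, hX, hY]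
      have ha := hL.a_eq
      rw [hw1, mul_one] at ha
      rw [ha] at e
      simp only [numX, numY]
      constructor
      · linear_combination (algebraMap R L b * x₀ ^ 2 + algebraMap R L b ^ 2 * x₀) * h3
      · linear_combination -y₀ * e
    · exact isogeny_eq_product (baseChange_curve a b) hL h₀ hq h₁ h₂
        ((isGenerator_some_iff h hq).mp hQ) hd hsub hadd hX hY
  obtain ⟨rfl, rfl⟩ := key
  exact ⟨hns, hψP⟩

end universal

/-! ### The image of the three-torsion -/

section quotient

variable {R : Type} [CommRing R] {a b κ k w w' a' b' κ' : R}

/-- Since `den` is linear in x, the equation is a monic cubic, even when κ = 0. -/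
lemma exists_numX_eq {F : Type} [Field F] [IsAlgClosed F] (b κ w X₁ : F) :
    ∃ x, den κ w x ^ 2 * X₁ = numX b w x := by
  let p : F[X] := X ^ 3 + (C (b * w * (4 - w) - X₁ * κ ^ 2) * X ^ 2 +
    C (b ^ 2 * w * (4 - w) - 2 * X₁ * w * κ) * X - C (X₁ * w ^ 2))
  have hp : p.natDegree = 3 := by
    simp only [p]
    compute_degree!
  obtain ⟨x, hx⟩ := IsAlgClosed.exists_root p
    (by rw [Polynomial.degree_eq_natDegree (by rintro h0; simp [h0] at hp), hp]; norm_num)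
  refine ⟨x, ?_⟩
  simp only [p, Polynomial.IsRoot, eval_add, eval_sub, eval_mul, eval_pow, eval_X, eval_C] at hx
  simp only [den, numX]
  linear_combination -hx

variable {L : Type} [Field L] [IsAlgClosed L] [Algebra R L]

/-- A root x of the cubic for X₁ has nonzero denominator, since otherwise `numY` would vanish as
well. A point above x then maps to ±P', and negating it corrects the sign. -/
lemma IsGivenByFormulas.exists_preimage {ψ : overBase (curve a b) ⟶ overBase (curve a' b')}
    (hψ : IsGivenByFormulas b κ k w ψ) (h : Admissible a b κ k w w') (ha' : a' = -(b * w' * k))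
    (hb' : b' = b ^ 3) [(curve a' b').IsElliptic] (P' : ((curve a' b')⁄L).toAffine.Point) :
    ∃ P : ((curve a b)⁄L).toAffine.Point, point P ≫ ψ.left = point P' := by
  classical
  rcases P' with _ | ⟨X₁, Y₁, hns⟩
  · exact ⟨0, (hψ L).1⟩
  have := h.isElliptic
  have hL := h.map (algebraMap R L)
  have h2 := hL.isUnit_two.ne_zero
  obtain ⟨x, hx⟩ := exists_numX_eq (algebraMap R L b) (algebraMap R L κ) (algebraMap R L w) X₁
  have hd : den (algebraMap R L κ) (algebraMap R L w) x ≠ 0 := by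
    intro hd
    obtain ⟨y, hy⟩ := exists_equation h2 (algebraMap R L a) (algebraMap R L b) x
    apply numY_ne_zero hL hy hd
    have hn := num_equation hL hy
    rw [← hx, hd] at hn
    apply (pow_eq_zero_iff two_ne_zero).mp
    linear_combination hn
  have key : ∀ y : L, y ^ 2 + algebraMap R L a * x * y + algebraMap R L a * algebraMap R L b * y =
      x ^ 3 + algebraMap R L b * x ^ 2 →
      den (algebraMap R L κ) (algebraMap R L w) x ^ 3 * Y₁ =
        numY (algebraMap R L b) (algebraMap R L k) (algebraMap R L w) x y →
      ∃ P : ((curve a b)⁄L).toAffine.Point, point P ≫ ψ.left = point (.some X₁ Y₁ hns) :=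
    fun y hy hY => ⟨.some x y (nonsingular_curve hy), ((hψ L).2 x y _).2 X₁ Y₁ hns hd hx hY⟩
  obtain ⟨y, hy⟩ := exists_equation h2 (algebraMap R L a) (algebraMap R L b) x
  obtain ⟨X₂, Y₂, hns', hX, hY, -⟩ := hψ.exists_image h ha' hb' (nonsingular_curve hy) hd
  obtain rfl : X₁ = X₂ := mul_left_cancel₀ (pow_ne_zero 2 hd) (hx.trans hX.symm)
  rcases Y_eq_of_X_eq hns.1 hns'.1 rfl with h3 | h3
  · exact key y hy (h3 ▸ hY)
  · have hy' : (-y - algebraMap R L a * x - algebraMap R L a * algebraMap R L b) ^ 2 +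
        algebraMap R L a * x * (-y - algebraMap R L a * x - algebraMap R L a * algebraMap R L b) +
        algebraMap R L a * algebraMap R L b *
          (-y - algebraMap R L a * x - algebraMap R L a * algebraMap R L b) =
        x ^ 3 + algebraMap R L b * x ^ 2 := by linear_combination hy
    refine key _ hy' ?_
    have n1 := numY_add_numY hL hy
    have n2 := numY_add_numY hL hy'
    rw [h3, curve_negY (baseChange_curve a' b')]
    simp only [ha', hb', map_neg, map_mul, map_pow]
    rw [← hX, ← hY] at n1
    rw [← hX] at n2
    apply mul_left_cancel₀ h2
    linear_combination -n1 - n2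

/-- Outside the kernel of ψ, the dual denominator at the image of T is a nonzero multiple of
ψ₃(x(T)), so it vanishes exactly when 3T = 0. Surjectivity of ψ then covers every T'. -/
lemma IsGivenByFormulas.isQuotientParameter {ψ : overBase (curve a b) ⟶ overBase (curve a' b')}
    (hψ : IsGivenByFormulas b κ k w ψ) (h : Admissible a b κ k w w') (ha' : a' = -(b * w' * k))
    (hb' : b' = b ^ 3) (hκ' : b ^ 3 * κ' = w' - 1) : IsQuotientParameter a' b' κ' ψ := by
  intro L _ _ _ _ Q
  have h' := h.dual ha' hb' hκ'
  have := h'.isElliptic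
  have hL := h.map (algebraMap R L)
  have hκL : algebraMap R L b ^ 3 * algebraMap R L κ' = algebraMap R L w' - 1 := by
    simpa using congrArg (algebraMap R L) hκ'
  rw [isGenerator_iff h']
  have key : ({P | IsInKernel κ' w' P} : Set ((curve a' b')⁄L).toAffine.Point) =
      {T' | ∃ T : ((curve a b)⁄L).toAffine.Point, 3 • T = 0 ∧ point T ≫ ψ.left = point T'} := by
    ext T'
    simp only [Set.mem_ofPred_eq]
    have main : ∀ T : ((curve a b)⁄L).toAffine.Point, point T ≫ ψ.left = point T' →
        (IsInKernel κ' w' T' ↔ 3 • T = 0) := by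
      intro T hT
      rcases T with _ | ⟨x, y, hns⟩
      · change point 0 ≫ ψ.left = _ at hT
        rw [(hψ L).1] at hT
        rw [← point_injective hT]
        exact iff_of_true trivial (smul_zero 3)
      · have e := (curve_equation_iff (baseChange_curve a b)).mp hns.1
        have hiff : 3 • Point.some x y hns = 0 ↔
            threeDivPoly (algebraMap R L a) (algebraMap R L b) x = 0 :=
          ⟨threeDivPoly_eq_zero (baseChange_curve a b) hns hL.isUnit_two.ne_zero,
            three_torsion (baseChange_curve a b) hns hL.isUnit_two.ne_zero⟩
        rw [hiff]
        by_cases hd : den (algebraMap R L κ) (algebraMap R L w) x = 0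
        · rw [((hψ L).2 x y hns).1 hd] at hT
          rw [← point_injective hT]
          exact iff_of_true trivial (threeDivPoly_eq_zero_of_den hL hd)
        · obtain ⟨X₁, Y₁, hns', hX, hY, hP⟩ := hψ.exists_image h ha' hb' hns hd
          rw [hP] at hT
          rw [← point_injective hT]
          obtain ⟨i, -⟩ := composite_coordinates hL hκL e hd hX hY
          change den (algebraMap R L κ') (algebraMap R L w') X₁ = 0 ↔ _
          rw [← neg_eq_zero (a := threeDivPoly _ _ _), ← i, mul_eq_zero, mul_eq_zero,
            or_iff_left (pow_ne_zero 4 hL.isUnit_b.ne_zero), or_iff_left (pow_ne_zero 3 hd)]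
    constructor
    · intro hT'
      obtain ⟨T, hT⟩ := hψ.exists_preimage h ha' hb' T'
      exact ⟨T, (main T hT).mp hT', hT⟩
    · rintro ⟨T, h3, hT⟩
      exact (main T hT).mpr h3
  rw [key]

end quotient

/-! ### The composite of the isogeny and its dual on geometric points -/

section composite

lemma comp_comp_eq {X₀ X₁ X₂ X₃ : Scheme} {f : X₀ ⟶ X₁} {g : X₁ ⟶ X₂} {g' : X₂ ⟶ X₃}
    {p : X₀ ⟶ X₂} {q : X₀ ⟶ X₃} (h₁ : f ≫ g = p) (h₂ : p ≫ g' = q) : (f ≫ g) ≫ g' = q := by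
  rw [h₁, h₂]

lemma comp_left_assoc {B T : Scheme} {X₀ X₁ X₂ X₃ : Over B} (p : T ⟶ X₀.left) (f : X₀ ⟶ X₁)
    (g : X₁ ⟶ X₂) (h : X₂ ⟶ X₃) :
    p ≫ (f ≫ g ≫ h).left = ((p ≫ f.left) ≫ g.left) ≫ h.left := by
  simp

lemma comp_hom_left_inv_left {B T : Scheme} {X₀ X₁ : Over B} (p : T ⟶ X₀.left) (e : X₀ ≅ X₁) :
    (p ≫ e.hom.left) ≫ e.inv.left = p := by
  rw [Category.assoc, ← Over.comp_left, e.hom_inv_id, Over.id_left, Category.comp_id]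

variable {R : Type} [CommRing R] {a b κ k w w' a' b' κ' a'' b'' t : R}

/-- If a denominator vanishes, at P or at its image, then both sides are the identity because 3P =
0. Otherwise the coordinates are compared. -/
lemma point_comp_comp {ψ : overBase (curve a b) ⟶ overBase (curve a' b')}
    {ψ' : overBase (curve a' b') ⟶ overBase (curve a'' b'')}
    {ι : overBase (curve a b) ⟶ overBase (curve a'' b'')}
    (h : Admissible a b κ k w w') (hψ : IsGivenByFormulas b κ k w ψ)
    (hψ' : IsGivenByFormulas b' κ' (-(b * k)) w' ψ') (hι : IsScaling t ι)
    (ha' : a' = -(b * w' * k)) (hb' : b' = b ^ 3) (hκ' : b ^ 3 * κ' = w' - 1)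
    (ha'' : a'' = -(b' * w * -(b * k))) (hb'' : b'' = b' ^ 3) (ht : b ^ 4 * t = 1)
    [(curve a'' b'').IsElliptic]
    {L : Type} [Field L] [DecidableEq L] [IsAlgClosed L] [Algebra R L]
    (P : ((curve a b)⁄L).toAffine.Point) :
    (point P ≫ ψ.left) ≫ ψ'.left = point ((-3 : ℤ) • P) ≫ ι.left := by
  have h' := h.dual ha' hb' hκ'
  have := h.isElliptic
  have := h'.isElliptic
  have hL := h.map (algebraMap R L)
  have h2 := hL.isUnit_two.ne_zero
  have hbL := hL.isUnit_b.ne_zero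
  have hκL : algebraMap R L b ^ 3 * algebraMap R L κ' = algebraMap R L w' - 1 := by
    simpa using congrArg (algebraMap R L) hκ'
  have hs : (algebraMap R L t)⁻¹ = algebraMap R L b ^ 4 := by
    apply inv_eq_of_mul_eq_one_left
    simpa using congrArg (algebraMap R L) ht
  rcases P with _ | ⟨x, y, hP⟩
  · change (point 0 ≫ ψ.left) ≫ ψ'.left = point ((-3 : ℤ) • 0) ≫ ι.left
    rw [smul_zero]
    exact (comp_comp_eq (hψ L).1 (hψ' L).1).trans (hι L).1.symm
  have e := (curve_equation_iff (baseChange_curve a b)).mp hP.1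
  have zero_case : threeDivPoly (algebraMap R L a) (algebraMap R L b) x = 0 →
      point ((-3 : ℤ) • Point.some x y hP) ≫ ι.left =
        point (0 : ((curve a'' b'')⁄L).toAffine.Point) := by
    intro hT
    have h3 := three_torsion (baseChange_curve a b) hP h2 hT
    have h3' : (-3 : ℤ) • Point.some x y hP = 0 := by
      rw [neg_smul, neg_eq_zero]
      exact_mod_cast h3
    rw [h3', (hι L).1]
  by_cases hd : den (algebraMap R L κ) (algebraMap R L w) x = 0
  · exact (comp_comp_eq (((hψ L).2 x y hP).1 hd) (hψ' L).1).trans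
      (zero_case (threeDivPoly_eq_zero_of_den hL hd)).symm
  obtain ⟨X₁, Y₁, hns, hX, hY, hψP⟩ := hψ.exists_image h ha' hb' hP hd
  obtain ⟨i, hi⟩ := composite_coordinates hL hκL e hd hX hY
  by_cases hd' : den (algebraMap R L κ') (algebraMap R L w') X₁ = 0
  · refine (comp_comp_eq hψP (((hψ' L).2 X₁ Y₁ hns).1 hd')).trans (zero_case ?_).symm
    rw [hd', zero_mul, zero_mul] at i
    exact neg_eq_zero.mp i.symm
  have hT : threeDivPoly (algebraMap R L a) (algebraMap R L b) x ≠ 0 := by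
    rw [← neg_ne_zero, ← i]
    exact mul_ne_zero (mul_ne_zero hd' (pow_ne_zero 3 hd)) (pow_ne_zero 4 hbL)
  obtain ⟨X₂, Y₂, hns₂, hX₂, hY₂, hψP'⟩ := hψ'.exists_image h' ha'' hb'' hns hd'
  refine (comp_comp_eq hψP hψP').trans ?_
  -- Undoing the scaling by b⁴ brings the image back to the source curve, where it can be compared
  -- with -3P.
  obtain ⟨x', rfl⟩ : ∃ x', X₂ = algebraMap R L b ^ 8 * x' :=
    ⟨X₂ / algebraMap R L b ^ 8, by field_simp⟩
  obtain ⟨y', rfl⟩ : ∃ y', Y₂ = algebraMap R L b ^ 12 * y' :=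
    ⟨Y₂ / algebraMap R L b ^ 12, by field_simp⟩
  rw [hb', map_pow] at hX₂ hY₂
  rw [map_neg, map_mul] at hY₂
  obtain ⟨hx', hy'⟩ := hi x' y' hX₂ hY₂
  have hP' : ((curve a b)⁄L).toAffine.Nonsingular x' y' := by
    apply nonsingular_curve
    have e₂ := (curve_equation_iff (baseChange_curve a'' b'')).mp hns₂.1
    simp only [ha'', hb'', hb', map_neg, map_mul, map_pow] at e₂
    apply mul_left_cancel₀ (pow_ne_zero 24 hbL)
    have ha := hL.a_eq
    linear_combination e₂ + algebraMap R L b ^ 24 * (x' * y' + algebraMap R L b * y') * ha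
  rw [neg_three_smul (baseChange_curve a b) hP hP' h2 hT hx' hy']
  obtain ⟨hns₃, hι'⟩ := (hι L).2 x' y' hP'
  rw [hι']
  congr 1
  apply some_congr
  · rw [hs]; ring
  · rw [hs]; ring

end composite

/-! ### The universal parameters -/

/-- The number `w = 1 + b κ`. -/
def wS₃ : S₃ := 1 + bS₃ * κS₃

/-- The parameter of the image of the `3`-torsion. -/
def κS₃' : S₃ :=
  -(Ring.inverse (bS₃ ^ 3) * (bS₃ ^ 3 * κS₃ ^ 3 - 6 * bS₃ * κS₃ + aS₃ ^ 2 * Ring.inverse bS₃ - 8))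

/-- The number `w' = 1 + b' κ'`. -/
def wS₃' : S₃ := 1 + bS₃ ^ 3 * κS₃'

/-- The number `k = a / w`. -/
def kS₃ : S₃ := aS₃ * Ring.inverse wS₃

lemma isUnit_discS₃ : IsUnit (aS₃ ^ 2 * bS₃ ^ 4 * (aS₃ ^ 2 - 16 * bS₃)) := by
  have h := isUnit_disc.map (AdjoinRoot.of polyW)
  simp only [map_mul, map_pow, map_sub, map_ofNat] at h
  exact h

lemma isUnit_aS₃ : IsUnit aS₃ := isUnit_aS.map (AdjoinRoot.of polyW)

lemma isUnit_bS₃ : IsUnit bS₃ := isUnit_bS.map (AdjoinRoot.of polyW)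

lemma isUnit_two_S₃ : IsUnit (2 : S₃) := by
  have h4 : IsUnit ((4 : ℤ) : S₃) := by
    have h := IsLocalization.Away.algebraMap_isUnit (S := ZQuarter) (4 : ℤ)
    have h' := h.map ((AdjoinRoot.of polyW).comp
      ((algebraMap (MvPolynomial (Fin 2) ZQuarter) S).comp MvPolynomial.C))
    rwa [eq_intCast, map_intCast] at h'
  exact isUnit_of_dvd_unit ⟨2, by push_cast; norm_num⟩ h4

lemma root_equation :
    bS₃ ^ 4 * κS₃ ^ 4 - 6 * bS₃ ^ 2 * κS₃ ^ 2 + (aS₃ ^ 2 - 8 * bS₃) * κS₃ - 3 = 0 := by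
  have h : AdjoinRoot.mk polyW polyW = 0 := AdjoinRoot.mk_self
  have h2 : bS₃ ^ 2 * AdjoinRoot.of polyW (Ring.inverse (bS ^ 2)) = 1 := by
    rw [bS₃, ← map_pow, ← map_mul, Ring.mul_inverse_cancel _ (isUnit_bS.pow 2), map_one]
  have h4 : bS₃ ^ 4 * AdjoinRoot.of polyW (Ring.inverse (bS ^ 4)) = 1 := by
    rw [bS₃, ← map_pow, ← map_mul, Ring.mul_inverse_cancel _ (isUnit_bS.pow 4), map_one]
  conv at h => lhs; arg 2; rw [polyW]
  simp only [map_sub, map_add, map_mul, map_pow, AdjoinRoot.mk_X, AdjoinRoot.mk_C, map_ofNat] at h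
  change κS₃ ^ 4 - 6 * _ * κS₃ ^ 2 + (aS₃ ^ 2 - 8 * bS₃) * _ * κS₃ - 3 * _ = 0 at h
  linear_combination bS₃ ^ 4 * h + 6 * bS₃ ^ 2 * κS₃ ^ 2 * h2 - ((aS₃ ^ 2 - 8 * bS₃) * κS₃ - 3) * h4

lemma pow_mul_κS₃' : bS₃ ^ 3 * κS₃' = wS₃' - 1 := by rw [wS₃']; ring

/-- Formally κ' is -3/(b⁴κ). The equation W(κ) = 0 exhibits κ as a divisor of 3, and its cofactor
defines κ' also where κ is not invertible. -/
lemma b_mul_wS₃' : bS₃ * wS₃' =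
    bS₃ - (bS₃ ^ 4 * κS₃ ^ 3 - 6 * bS₃ ^ 2 * κS₃ + aS₃ ^ 2 - 8 * bS₃) := by
  have h1 := Ring.mul_inverse_cancel _ isUnit_bS₃
  have h3 := Ring.mul_inverse_cancel _ (isUnit_bS₃.pow 3)
  rw [wS₃', κS₃']
  linear_combination (-(bS₃ * (bS₃ ^ 3 * κS₃ ^ 3 - 6 * bS₃ * κS₃ + aS₃ ^ 2 * Ring.inverse bS₃ - 8))) *
    h3 - aS₃ ^ 2 * h1

lemma admissible_S₃ : Admissible aS₃ bS₃ κS₃ kS₃ wS₃ wS₃' := by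
  have hb := isUnit_bS₃
  have hr := root_equation
  have hw' := b_mul_wS₃'
  have hw : wS₃ = 1 + bS₃ * κS₃ := rfl
  -- Multiplied by b and expanded, this is the equation W(κ) = 0 up to a power of b.
  have hadd : wS₃ + wS₃' - wS₃ * wS₃' = 4 := by
    apply hb.mul_left_cancel
    rw [hw]
    linear_combination -(bS₃ * κS₃) * hw' + bS₃ * hr
  have hsq : aS₃ ^ 2 = -(bS₃ * wS₃ ^ 3 * wS₃') := by
    rw [hw]
    linear_combination (1 + bS₃ * κS₃) ^ 3 * hw'
      - (3 + 3 * (bS₃ * κS₃) + (bS₃ * κS₃) ^ 2) * bS₃ * hr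
  have hdisc : aS₃ ^ 2 - 16 * bS₃ = bS₃ * (wS₃ - 2) ^ 3 * (wS₃' - 2) := by
    rw [hsq]
    linear_combination bS₃ * (2 * wS₃ ^ 2 - 4 * wS₃ + 8) * hadd
  have hwu : IsUnit (bS₃ * wS₃ ^ 3 * wS₃') := by
    have := (isUnit_aS₃.pow 2).neg
    rwa [hsq, neg_neg] at this
  have hsu : IsUnit (bS₃ * (wS₃ - 2) ^ 3 * (wS₃' - 2)) := by
    rw [← hdisc]
    exact isUnit_of_mul_isUnit_right isUnit_discS₃
  have hwunit : IsUnit wS₃ := isUnit_of_dvd_unit ⟨bS₃ * wS₃ ^ 2 * wS₃', by ring⟩ hwu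
  have hinv := Ring.mul_inverse_cancel _ hwunit
  refine ⟨hb, hwunit, isUnit_of_dvd_unit ⟨bS₃ * wS₃ ^ 3, by ring⟩ hwu, isUnit_two_S₃,
    isUnit_of_dvd_unit ⟨bS₃ * (wS₃ - 2) ^ 2 * (wS₃' - 2), by ring⟩ hsu,
    isUnit_of_dvd_unit ⟨bS₃ * (wS₃ - 2) ^ 3, by ring⟩ hsu, ?_, ?_, hadd, by rw [hw]; ring⟩
  · rw [kS₃]
    linear_combination -aS₃ * hinv
  · rw [kS₃]
    linear_combination (Ring.inverse wS₃) ^ 2 * hsq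
      - bS₃ * wS₃ * wS₃' * (wS₃ * Ring.inverse wS₃ + 1) * hinv

lemma aS₃'_eq : aS₃' = -(bS₃ * wS₃' * kS₃) := admissible_S₃.targetA_eq

lemma admissible_S₃' : Admissible aS₃' bS₃' κS₃' (-(bS₃ * kS₃)) wS₃' wS₃ :=
  admissible_S₃.dual aS₃'_eq rfl pow_mul_κS₃'

end FrobeniusSquare

end

/-! ### Assembling the theorem -/

theorem mainTheorem6 :
    curveC.IsElliptic ∧ curveC'.IsElliptic ∧
    ∃ (ψ : overBase curveC ⟶ overBase curveC')
      (κ' : S₃)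
      (ψ' : overBase curveC' ⟶ overBase (curveC'' κ'))
      (m : overBase curveC ⟶ overBase curveC)
      (ι : overBase curveC ≅ overBase (curveC'' κ')),
      IsUniversalIsogeny aS₃ bS₃ κS₃ ψ ∧
      IsQuotientParameter aS₃' bS₃' κ' ψ ∧
      IsUniversalIsogeny aS₃' bS₃' κ' ψ' ∧
      (curveC'' κ').IsElliptic ∧
      IsMultiplicationBy (-3) m ∧
      IsScaling (Ring.inverse (bS₃ ^ 4)) ι.hom ∧
      ψ ≫ ψ' = m ≫ ι.hom := by
  have h := admissible_S₃
  have h' := admissible_S₃'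
  have ha'' : targetA aS₃' bS₃' κS₃' = -(bS₃' * wS₃ * -(bS₃ * kS₃)) := h'.targetA_eq
  have ht : bS₃ ^ 4 * Ring.inverse (bS₃ ^ 4) = 1 :=
    Ring.mul_inverse_cancel _ (isUnit_bS₃.pow 4)
  have hC := h.isElliptic
  have hC' := h'.isElliptic
  have hC'' : (curveC'' κS₃').IsElliptic := by
    -- The parameter c of the next dual step serves only to apply `Admissible.dual` once more, which
    -- gives ellipticity of C'/G'.
    obtain ⟨c, hc⟩ := (h'.isUnit_b.pow 3).dvd (a := wS₃ - 1)
    exact (h'.dual ha'' rfl hc.symm).isElliptic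
  obtain ⟨ψ, hψ⟩ := exists_isogeny h aS₃'_eq (b' := bS₃') rfl
  obtain ⟨ψ', hψ'⟩ := exists_isogeny h' ha'' (b' := targetB bS₃') rfl
  have hs : IsScaledBy (bS₃ ^ 4) curveC (curveC'' κS₃') := by
    have ha : targetA aS₃' bS₃' κS₃' = bS₃ ^ 4 * aS₃ := by
      rw [ha'', h.a_eq, bS₃', targetB]; ring
    have hb : targetB bS₃' = (bS₃ ^ 4) ^ 2 * bS₃ := by
      rw [targetB, bS₃', targetB]; ring
    refine ⟨ha, hb, ?_, (mul_zero _).symm, (mul_zero _).symm⟩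
    change targetA aS₃' bS₃' κS₃' * targetB bS₃' = (bS₃ ^ 4) ^ 3 * (aS₃ * bS₃)
    rw [ha, hb]; ring
  obtain ⟨ι, hι⟩ := exists_scaling hs ht
  -- With m chosen as ι⁻¹ ∘ ψ' ∘ ψ, the equality of morphisms is formal; what remains is the action
  -- of m on geometric points.
  refine ⟨hC, hC', ψ, κS₃', ψ', ψ ≫ ψ' ≫ ι.inv, ι, hψ.isUniversalIsogeny h aS₃'_eq rfl,
    hψ.isQuotientParameter h aS₃'_eq rfl pow_mul_κS₃', hψ'.isUniversalIsogeny h' ha'' rfl, hC'',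
    ?_, hι, by simp⟩
  intro L _ _ _ _ P
  have key := point_comp_comp h hψ hψ' hι aS₃'_eq rfl pow_mul_κS₃' ha'' rfl ht P
  exact (comp_left_assoc _ _ _ _).trans
    ((congrArg (fun f => f ≫ ι.inv.left) key).trans (comp_hom_left_inv_left _ ι))
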